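/- Let $(M,d)$ be a complete metric space that is doubling: for some $\kappa\in\mathbb N$ every ball $B(x,2r)$ is covered by $\kappa$ balls of radius $r$ (all balls are open). Let $I$ be a finite index set with at least two elements, let $I^*$ be the set of nonempty finite words over $I$, and let $\{\varphi_i\}_{i\in I}$ be an iterated function system (IFS) on $M$, i.e. each $\varphi_i\colon M\to M$ is injective and $d(\varphi_i(x),\varphi_i(y))\le c_i\,d(x,y)$ for all $x,y$ with some $0<c_i<1$. Let $E$ be its invariant set, the unique nonempty compact set with $E=\bigcup_{i\in I}\varphi_i(E)$. For a word $\mathtt i=i_1\cdots i_n$ put $\varphi_{\mathtt i}=\varphi_{i_1}\circ\cdots\circ\varphi_{i_n}$, $E_{\mathtt i}=\varphi_{\mathtt i}(E)$ and $\mathtt i^-=i_1\cdots i_{n-1}$, with $\varphi_\varnothing=\mathrm{id}$, $E_\varnothing=E$ for the empty word. Write $\mathtt i\perp\mathtt j$ if neither of the words $\mathtt i,\mathtt j$ is a prefix of the other. Assume that the IFS is properly semiconformal, that is: (a) $\operatorname{diam}(E)>0$ and there are $D\ge1$ and numbers $0<\underline s_{\mathtt i}\le\overline s_{\mathtt i}<1$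 with $\overline s_{\mathtt i}\le D\,\underline s_{\mathtt i}$ such that $\underline s_{\mathtt i}d(x,y)\le d(\varphi_{\mathtt i}(x),\varphi_{\mathtt i}(y))\le\overline s_{\mathtt i}d(x,y)$ for all $x,y\in M$, $\mathtt i\in I^*$; (b) there is a dense open set $W\subsetneq M$ with $W\cap E\ne\emptyset$ such that for each $x\in W$ there is $\lambda_x\ge1$ with $\operatorname{dist}(\varphi_{\mathtt i}(x),\varphi_{\mathtt i}(M\setminus W))\le\lambda_x\operatorname{dist}(\varphi_{\mathtt i}(x),M\setminus\varphi_{\mathtt i}(W))$ for all $\mathtt i\in I^*$. Then there is exactly one $t\ge0$ with $P(t)=0$, where $$P(t)=\lim_{n\to\infty}\frac1n\log\sum_{\mathtt i\in I^n}\operatorname{diam}(E_{\mathtt i})^t ,$$ and for this $t$ the following four conditions are equivalent, where $\mathcal H^t$ is the $t$-dimensional Hausdorff measure: 1. (Ball condition) $\{E_{\mathtt i}\}$ is a weakly controlled Moran construction satisfying the ball condition. The first part means that the $E_{\mathtt i}$ are compact with positive diameter and that, for some constant $D'\ge1$ and all $\mathtt i,\mathtt j\in I^*$: $E_{\mathtt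 i}\subset E_{\mathtt i^-}$; $\max_{\mathtt k\in I^n}\operatorname{diam}(E_{\mathtt k})<1/D'$ for some $n\ge1$; $\operatorname{diam}(E_{\mathtt i\mathtt j})\le D'\operatorname{diam}(E_{\mathtt i})\operatorname{diam}(E_{\mathtt j})$; $\operatorname{diam}(E_{\mathtt i})\ge\operatorname{diam}(E_{\mathtt i^-})/D'$. The second part means that there is $0<\delta<1$ such that for each $x\in E$ there is $r_x>0$ such that for each $0<r<r_x$ one can choose points $x_{\mathtt i}\in M$, $\mathtt i\in Z(x,r)$, with $\operatorname{dist}(x_{\mathtt i},E_{\mathtt i})<r$ and with $B(x_{\mathtt i},\delta r)\cap B(x_{\mathtt j},\delta r)=\emptyset$ for distinct $\mathtt i,\mathtt j\in Z(x,r)$; here $Z(x,r)=\{\mathtt i\in I^*:\operatorname{diam}(E_{\mathtt i})\le r<\operatorname{diam}(E_{\mathtt i^-}),\ E_{\mathtt i}\cap B(x,r)\ne\emptyset\}$. 2. $\mathcal H^t(E)>0$. 3. (Open set condition) There is a nonempty open set $U\subset M$ with $\varphi_{\mathtt i}(U)\cap\varphi_{\mathtt j}(U)=\emptyset$ whenever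 $\mathtt i\perp\mathtt j$. 4. (Strong open set condition) There is such a set $U$ with $U\cap E\ne\emptyset$. -/

import Mathlib

open Set Filter Topology MeasureTheory

noncomputable section

namespace MoranIFS

variable {ι M : Type*}

/-- A metric space is doubling if for some `κ` every ball `B(x, 2r)` can be covered by `κ` balls of
radius `r`. -/
def IsDoubling (M : Type*) [MetricSpace M] : Prop :=
  ∃ κ : ℕ, ∀ (x : M) (r : ℝ), 0 < r →
    ∃ s : Finset M, s.card ≤ κ ∧ Metric.ball x (2 * r) ⊆ ⋃ y ∈ s, Metric.ball y r

/-! ### Words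

Finite words over the alphabet `ι` are lists. The parent `i⁻` of a nonempty word is
`List.dropLast`; for a word of length one it is the empty word. -/

/-- Two finite words are incomparable if no infinite word extends both, that is, if neither is a
prefix of the other. -/
def Incomparable (i j : List ι) : Prop := ¬ i <+: j ∧ ¬ j <+: i

/-- The initial segment of length `n` of an infinite word. -/
def initialWord (ω : ℕ → ι) (n : ℕ) : List ι := List.ofFn fun k : Fin n => ω k

/-! ### Moran constructions

A family of sets is indexed by finite words; its value at the empty word plays the role of the set
`X_{i⁻}` for the words `i` of length one. -/

/-- Weakly controlled Moran constructions. -/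
def IsWCMC [MetricSpace M] (X : List ι → Set M) : Prop :=
  (∀ i, IsCompact (X i) ∧ 0 < Metric.diam (X i)) ∧
  ∃ D : ℝ, 1 ≤ D ∧
    (∀ i, i ≠ [] → X i ⊆ X i.dropLast) ∧
    (∃ n : ℕ, 1 ≤ n ∧ ∀ i : List ι, i.length = n → Metric.diam (X i) < D⁻¹) ∧
    (∀ i j, i ≠ [] → j ≠ [] →
      Metric.diam (X (i ++ j)) ≤ D * Metric.diam (X i) * Metric.diam (X j)) ∧
    (∀ i, i ≠ [] → D⁻¹ * Metric.diam (X i.dropLast) ≤ Metric.diam (X i))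

/-- The limit set: all points lying in `⋂ n ≥ 1, X (ω|n)` for some infinite word `ω`. -/
def limitSet (X : List ι → Set M) : Set M :=
  {x | ∃ ω : ℕ → ι, ∀ n : ℕ, 1 ≤ n → x ∈ X (initialWord ω n)}

/-- `HasPressure X t p` says that the limit defining the topological pressure of `X` at `t` exists
and that it equals `p`, i.e. `P(t) = p`. -/
def HasPressure [Fintype ι] [MetricSpace M] (X : List ι → Set M) (t p : ℝ) : Prop :=
  Tendsto
    (fun n : ℕ =>
      1 / (n : ℝ) * Real.log (∑ w : Fin n → ι, Metric.diam (X (List.ofFn w)) ^ t))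
    atTop (𝓝 p)

/-- `Z(r)`: the words whose set is the first one of diameter at most `r` along the word. -/
def stoppingWords [MetricSpace M] (X : List ι → Set M) (r : ℝ) : Set (List ι) :=
  {i | i ≠ [] ∧ Metric.diam (X i) ≤ r ∧ r < Metric.diam (X i.dropLast)}

/-- `Z(x, r)`: the words in `Z(r)` whose set meets the ball `B(x, r)`. -/
def stoppingWordsAt [MetricSpace M] (X : List ι → Set M) (x : M) (r : ℝ) : Set (List ι) :=
  {i ∈ stoppingWords X r | (X i ∩ Metric.ball x r).Nonempty}

/-- The ball condition for a weakly controlled Moran construction. The disjointness is that of an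
indexed family: distinct words have disjoint balls. -/
def MoranBallCondition [MetricSpace M] (X : List ι → Set M) : Prop :=
  ∃ δ : ℝ, 0 < δ ∧ δ < 1 ∧
    ∀ x ∈ limitSet X, ∃ R : ℝ, 0 < R ∧ ∀ r : ℝ, 0 < r → r < R →
      ∃ c : List ι → M,
        (∀ i ∈ stoppingWordsAt X x r, Metric.infDist (c i) (X i) < r) ∧
        (stoppingWordsAt X x r).PairwiseDisjoint fun i => Metric.ball (c i) (δ * r)

/-! ### Iterated function systems -/

/-- An iterated function system: contractive injections of `M` into itself. -/
def IsIFS [MetricSpace M] (φ : ι → M → M) : Prop :=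
  ∀ i, Function.Injective (φ i) ∧
    ∃ s : ℝ, 0 < s ∧ s < 1 ∧ ∀ x y, dist (φ i x) (φ i y) ≤ s * dist x y

/-- `E` is the invariant set of the system. -/
def IsInvariantSet [MetricSpace M] (φ : ι → M → M) (E : Set M) : Prop :=
  E.Nonempty ∧ IsCompact E ∧ E = ⋃ i, φ i '' E

/-- The composition `φ_{i₁} ∘ ⋯ ∘ φ_{iₙ}` along a word. -/
def wordMap (φ : ι → M → M) : List ι → M → M
  | [] => id
  | i :: w => φ i ∘ wordMap φ w

/-- The images `E_i = φ_i(E)` indexed by words. -/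
def pieces (φ : ι → M → M) (E : Set M) (i : List ι) : Set M := wordMap φ i '' E

/-- Semiconformality of an iterated function system with invariant set `E`. -/
def IsSemiconformal [MetricSpace M] (φ : ι → M → M) (E : Set M) : Prop :=
  0 < Metric.diam E ∧
  ∃ (D : ℝ) (sLow sUp : List ι → ℝ), 1 ≤ D ∧
    ∀ i : List ι, i ≠ [] →
      0 < sLow i ∧ sLow i ≤ sUp i ∧ sUp i < 1 ∧ sUp i ≤ D * sLow i ∧
      ∀ x y : M, sLow i * dist x y ≤ dist (wordMap φ i x) (wordMap φ i y) ∧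
        dist (wordMap φ i x) (wordMap φ i y) ≤ sUp i * dist x y

/-- An essential open set is a dense open set which meets `E`. -/
def IsEssentialOpen [MetricSpace M] (E W : Set M) : Prop :=
  IsOpen W ∧ Dense W ∧ (W ∩ E).Nonempty

/-- Proper semiconformality of an iterated function system with invariant set `E`. Both sets to
which distances are taken are nonempty because `W ≠ univ` and the maps are injective. -/
def IsProperlySemiconformal [MetricSpace M] (φ : ι → M → M) (E : Set M) : Prop :=
  IsSemiconformal φ E ∧
  ∃ W : Set M, IsEssentialOpen E W ∧ W ≠ univ ∧
    ∀ x ∈ W, ∃ lam : ℝ, 1 ≤ lam ∧ ∀ i : List ι, i ≠ [] →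
      Metric.infDist (wordMap φ i x) (wordMap φ i '' Wᶜ) ≤
        lam * Metric.infDist (wordMap φ i x) (wordMap φ i '' W)ᶜ

/-- The ball condition for an iterated function system: the images of the invariant set form a
weakly controlled Moran construction satisfying the ball condition. -/
def BallCondition [MetricSpace M] (φ : ι → M → M) (E : Set M) : Prop :=
  IsWCMC (pieces φ E) ∧ MoranBallCondition (pieces φ E)

/-- `U` is feasible: a nonempty open set whose images under incomparable words are disjoint. -/
def IsFeasible [MetricSpace M] (φ : ι → M → M) (U : Set M) : Prop :=
  U.Nonempty ∧ IsOpen U ∧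
    ∀ i j : List ι, Incomparable i j → Disjoint (wordMap φ i '' U) (wordMap φ j '' U)

/-- The open set condition. -/
def OpenSetCondition [MetricSpace M] (φ : ι → M → M) : Prop :=
  ∃ U : Set M, IsFeasible φ U

/-- The strong open set condition. -/
def StrongOpenSetCondition [MetricSpace M] (φ : ι → M → M) (E : Set M) : Prop :=
  ∃ U : Set M, IsFeasible φ U ∧ (U ∩ E).Nonempty

end MoranIFS

end

/-!
For a finite word `w` write `d w` for the diameter of the piece `E_w`. Semiconformality says that
`φ_w` multiplies all distances by `d w`, up to a constant `C` (`HasBoundedDistortion`). Hence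
`d (u ++ v)` is comparable with `d u * d v`, and the sums of `d w ^ t` over words of length `n` are
almost multiplicative in `n`. Fekete's lemma then gives the pressure, which is strictly decreasing
and Lipschitz in `t` and so has exactly one zero. At the zero the sums stay between two positive
constants, and so `∑ d (u ++ v) ^ t` over the words `v` of a given length is comparable with
`d u ^ t` (`levelSum_bounds`). These sums play the role of a conformal measure.

The equivalence rests on clusters (`IsCluster`): finite families of pairwise incomparable words
whose pieces are large compared with, and close to, the piece of one word `k`. If there is a word
`k` such that, for all `j`, the piece of `j ++ k` keeps a distance comparable with its diameter from
the pieces of all (not too small) words incomparable with `j`, then a small ball around a point of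
`E_k` is feasible and meets `E`. Otherwise a nearby piece of an incomparable word can be added to
any cluster at the price of composing with some `j`, and there are clusters of any size
(`exists_isCluster`). So the strong open set condition follows once the clusters are bounded in size,
which both the ball condition and positive Hausdorff measure ensure.

* Under the ball condition, a cluster around `k` is seen at arbitrarily small scales at the fixed
  point of `φ_k`, where doubling bounds the number of stopping words
  (`isCluster_card_le_of_moranBallCondition`).
* A cluster with `N` members lets one cover the `N` pieces by one set of comparable diameter.
  Repeating this inside the rest of every piece exhausts `E`, up to an arbitrarily small part, at
  total cost of the order of `1 / N`. So the Hausdorff measure of `E` is at most of that order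
  (`hausdorffMeasure_le`).

Conversely, under the open set condition, proper semiconformality puts genuine balls inside the
images of the feasible set, at a point of the dense open set `W`. This gives the ball condition with
uniform constants (`exists_hasBallsAt`). By doubling the number of stopping words is then bounded at
all points and scales, and the mass distribution principle gives positive Hausdorff measure
(`hausdorffMeasure_pos`).
-/

namespace MoranIFS

variable {ι M : Type*}

/-! ### Words -/

theorem Incomparable.symm {i j : List ι} (h : Incomparable i j) : Incomparable j i := ⟨h.2, h.1⟩

theorem Incomparable.ne {i j : List ι} (h : Incomparable i j) : i ≠ j := by
  rintro rfl
  exact h.1 List.prefix_rfl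

theorem incomparable_append_left (u : List ι) {i j : List ι} :
    Incomparable (u ++ i) (u ++ j) ↔ Incomparable i j := by
  simp [Incomparable, List.prefix_append_right_inj]

theorem Incomparable.mono {i j i' j' : List ι} (h : Incomparable i j) (hi : i <+: i')
    (hj : j <+: j') : Incomparable i' j' := by
  constructor
  · intro h'
    rcases List.prefix_or_prefix_of_prefix (hi.trans h') hj with h1 | h1
    exacts [h.1 h1, h.2 h1]
  · intro h'
    rcases List.prefix_or_prefix_of_prefix hi (hj.trans h') with h1 | h1
    exacts [h.1 h1, h.2 h1]

/-- The common initial segment of two incomparable words, extended by one letter of the second,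
is still incomparable with the first. -/
theorem Incomparable.exists_prefix {i j : List ι} (h : Incomparable i j) :
    ∃ p, p ≠ [] ∧ p <+: j ∧ Incomparable p i ∧ p.dropLast <+: i := by
  induction i generalizing j with
  | nil => exact absurd List.nil_prefix h.1
  | cons a u ih =>
    cases j with
    | nil => exact absurd List.nil_prefix h.2
    | cons a' u' =>
      by_cases haa : a = a'
      · subst haa
        have h' : Incomparable u u' := by
          simpa [Incomparable, List.cons_prefix_cons] using h
        obtain ⟨p, hp, hpj, hpi, hd⟩ := ih h'
        refine ⟨a :: p, by simp, by simpa [List.cons_prefix_cons] using hpj, ?_, ?_⟩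
        · simpa [Incomparable, List.cons_prefix_cons] using hpi
        · rw [List.dropLast_cons_of_ne_nil hp]
          simpa [List.cons_prefix_cons] using hd
      · refine ⟨[a'], by simp, by simp [List.cons_prefix_cons], ?_, by simp⟩
        simp [Incomparable, List.cons_prefix_cons, haa, Ne.symm haa]

section WordsOfLength

variable [Fintype ι]

open Classical in
/-- The finite set `ι^n` of words of length `n`. -/
noncomputable def wordsOfLength (ι : Type*) [Fintype ι] (n : ℕ) : Finset (List ι) :=
  Finset.univ.image (List.ofFn : (Fin n → ι) → List ι)

@[simp] theorem mem_wordsOfLength {n : ℕ} {w : List ι} :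
    w ∈ wordsOfLength ι n ↔ w.length = n := by
  classical
  simp only [wordsOfLength, Finset.mem_image, Finset.mem_univ, true_and]
  constructor
  · rintro ⟨f, rfl⟩
    simp
  · rintro rfl
    exact ⟨w.get, List.ofFn_get w⟩

theorem sum_wordsOfLength {R : Type*} [AddCommMonoid R] (n : ℕ) (f : List ι → R) :
    ∑ w ∈ wordsOfLength ι n, f w = ∑ w : Fin n → ι, f (List.ofFn w) := by
  classical
  rw [wordsOfLength, Finset.sum_image]
  exact fun a _ b _ h => List.ofFn_injective h

theorem sum_wordsOfLength_add {R : Type*} [AddCommMonoid R] (m n : ℕ) (f : List ι → R) :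
    ∑ w ∈ wordsOfLength ι (m + n), f w =
      ∑ u ∈ wordsOfLength ι m, ∑ v ∈ wordsOfLength ι n, f (u ++ v) := by
  rw [← Finset.sum_product']
  refine Finset.sum_nbij' (fun w => (w.take m, w.drop m)) (fun p => p.1 ++ p.2) ?_ ?_ ?_ ?_ ?_
  · intro w hw
    simp only [mem_wordsOfLength] at hw
    simp [hw]
  · rintro ⟨u, v⟩ h
    simp only [Finset.mem_product, mem_wordsOfLength] at h
    simp [h.1, h.2]
  · intro w _
    simp
  · rintro ⟨u, v⟩ h
    simp only [Finset.mem_product, mem_wordsOfLength] at h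
    simp [← h.1]
  · intro w _
    simp

@[simp] theorem wordsOfLength_zero : wordsOfLength ι 0 = {[]} := by
  ext w
  simp

end WordsOfLength

/-! ### Compositions of the maps and pieces of the invariant set -/

theorem wordMap_append (φ : ι → M → M) (u v : List ι) :
    wordMap φ (u ++ v) = wordMap φ u ∘ wordMap φ v := by
  induction u with
  | nil => rfl
  | cons a u ih => simp only [List.cons_append, wordMap, ih, Function.comp_assoc]

theorem pieces_append (φ : ι → M → M) (E : Set M) (u v : List ι) :
    pieces φ E (u ++ v) = wordMap φ u '' pieces φ E v := by
  simp only [pieces, wordMap_append, image_comp]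

theorem pieces_nil (φ : ι → M → M) (E : Set M) : pieces φ E [] = E := by
  simp [pieces, wordMap]

section

variable [MetricSpace M] {φ : ι → M → M} {E : Set M}

theorem IsInvariantSet.pieces_subset (hE : IsInvariantSet φ E) (w : List ι) :
    pieces φ E w ⊆ E := by
  induction w with
  | nil => rw [pieces_nil]
  | cons a w ih =>
    have : pieces φ E (a :: w) = φ a '' pieces φ E w := by
      simp only [pieces, wordMap, image_comp]
    rw [this]
    refine (image_mono ih).trans ?_
    conv_rhs => rw [hE.2.2]
    exact subset_iUnion (fun i => φ i '' E) a

theorem IsInvariantSet.pieces_append_subset (hE : IsInvariantSet φ E) (u v : List ι) :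
    pieces φ E (u ++ v) ⊆ pieces φ E u := by
  rw [pieces_append]
  exact image_mono (hE.pieces_subset v)

theorem IsInvariantSet.pieces_subset_of_prefix (hE : IsInvariantSet φ E) {u v : List ι}
    (h : u <+: v) : pieces φ E v ⊆ pieces φ E u := by
  obtain ⟨w, rfl⟩ := h
  exact hE.pieces_append_subset u w

theorem IsInvariantSet.exists_mem_pieces (hE : IsInvariantSet φ E) {x : M} (hx : x ∈ E) (n : ℕ) :
    ∃ v : List ι, v.length = n ∧ x ∈ pieces φ E v := by
  induction n generalizing x with
  | zero => exact ⟨[], rfl, by rwa [pieces_nil]⟩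
  | succ n ih =>
    rw [hE.2.2] at hx
    obtain ⟨i, y, hy, rfl⟩ := mem_iUnion.1 hx
    obtain ⟨v, hv, hyv⟩ := ih hy
    refine ⟨i :: v, by simp [hv], ?_⟩
    rw [← List.singleton_append, pieces_append]
    exact ⟨y, hyv, rfl⟩

theorem IsInvariantSet.exists_mem_pieces_append (hE : IsInvariantSet φ E) {x : M} {u : List ι}
    (hx : x ∈ pieces φ E u) (n : ℕ) :
    ∃ v : List ι, v.length = n ∧ x ∈ pieces φ E (u ++ v) := by
  obtain ⟨y, hy, rfl⟩ := hx
  obtain ⟨v, hv, hyv⟩ := hE.exists_mem_pieces hy n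
  exact ⟨v, hv, by rw [pieces_append]; exact ⟨y, hyv, rfl⟩⟩

/-- Every point of the invariant set is coded by an infinite word. -/
theorem IsInvariantSet.subset_limitSet (hE : IsInvariantSet φ E) :
    E ⊆ limitSet (pieces φ E) := by
  intro x hx
  have step : ∀ y : E, ∃ p : ι × E, φ p.1 p.2 = y := by
    rintro ⟨y, hy⟩
    rw [hE.2.2] at hy
    obtain ⟨i, z, hz, rfl⟩ := mem_iUnion.1 hy
    exact ⟨(i, ⟨z, hz⟩), rfl⟩
  choose p hp using step
  -- the orbit of `x` under the chosen inverse branches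
  let z : ℕ → E := fun n => (fun y => (p y).2)^[n] ⟨x, hx⟩
  let ω : ℕ → ι := fun n => (p (z n)).1
  have hz : ∀ n, φ (ω n) (z (n + 1)) = z n := by
    intro n
    simp only [z, Function.iterate_succ_apply']
    exact hp _
  have key : ∀ n, wordMap φ (initialWord ω n) (z n) = x := by
    intro n
    induction n with
    | zero => simp [initialWord, wordMap, z]
    | succ n ih =>
      have : initialWord ω (n + 1) = initialWord ω n ++ [ω n] := by
        simp only [initialWord, List.ofFn_succ_last]
        rfl
      rw [this, wordMap_append, ← ih]
      simp only [Function.comp, wordMap, id]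
      rw [hz]
  exact ⟨ω, fun n _ => ⟨z n, (z n).2, key n⟩⟩

/-- The diameter of the piece indexed by the word `w`. -/
noncomputable abbrev pieceDiam (φ : ι → M → M) (E : Set M) (w : List ι) : ℝ :=
  Metric.diam (pieces φ E w)

/-- Invariant sets whose maps have bounded distortion: along every finite word, distances are
multiplied by the diameter of the corresponding piece, up to the factor `C`. The constants `b` and
`c` bound from below and above how fast the diameters decrease with the length of the word. -/
structure HasBoundedDistortion (φ : ι → M → M) (E : Set M) (C b c : ℝ) : Prop where
  invariant : IsInvariantSet φ E
  one_le : 1 ≤ C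
  b_pos : 0 < b
  c_pos : 0 < c
  c_lt_one : c < 1
  diam_pos : ∀ w, 0 < pieceDiam φ E w
  le_dist : ∀ w x y, pieceDiam φ E w * dist x y ≤ C * dist (wordMap φ w x) (wordMap φ w y)
  dist_le : ∀ w x y, dist (wordMap φ w x) (wordMap φ w y) ≤ C * pieceDiam φ E w * dist x y
  le_concat : ∀ w i, b * pieceDiam φ E w ≤ pieceDiam φ E (w ++ [i])
  diam_le : ∀ w, pieceDiam φ E w ≤ c ^ w.length * pieceDiam φ E []

namespace HasBoundedDistortion

variable {C b c : ℝ}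

theorem C_pos (h : HasBoundedDistortion φ E C b c) : 0 < C := zero_lt_one.trans_le h.one_le

end HasBoundedDistortion
end
end MoranIFS

namespace MoranIFS

variable {ι M : Type*} [MetricSpace M] {φ : ι → M → M} {E : Set M}

/-! ### Diameters of pieces -/

namespace HasBoundedDistortion

variable {C b c : ℝ}

theorem isCompact (h : HasBoundedDistortion φ E C b c) (w : List ι) :
    IsCompact (pieces φ E w) := by
  refine h.invariant.2.1.image ?_
  exact (LipschitzWith.of_dist_le_mul (K := (C * pieceDiam φ E w).toNNReal) fun x y => by
    rw [Real.coe_toNNReal _ (mul_nonneg h.C_pos.le (h.diam_pos w).le)]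
    exact h.dist_le w x y).continuous

theorem nonempty (h : HasBoundedDistortion φ E C b c) (w : List ι) :
    (pieces φ E w).Nonempty := h.invariant.1.image _

theorem dist_le_diam (h : HasBoundedDistortion φ E C b c) {w : List ι} {x y : M}
    (hx : x ∈ pieces φ E w) (hy : y ∈ pieces φ E w) : dist x y ≤ pieceDiam φ E w :=
  Metric.dist_le_diam_of_mem (h.isCompact w).isBounded hx hy

theorem diam_mono (h : HasBoundedDistortion φ E C b c) {u v : List ι} (huv : u <+: v) :
    pieceDiam φ E v ≤ pieceDiam φ E u :=
  Metric.diam_mono (h.invariant.pieces_subset_of_prefix huv) (h.isCompact u).isBounded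

theorem diam_append_le (h : HasBoundedDistortion φ E C b c) (u v : List ι) :
    pieceDiam φ E (u ++ v) ≤ C * pieceDiam φ E u * pieceDiam φ E v := by
  have hu := mul_nonneg h.C_pos.le (h.diam_pos u).le
  refine Metric.diam_le_of_forall_dist_le (mul_nonneg hu (h.diam_pos v).le) ?_
  rw [pieces_append]
  rintro _ ⟨x, hx, rfl⟩ _ ⟨y, hy, rfl⟩
  exact (h.dist_le u x y).trans (mul_le_mul_of_nonneg_left (h.dist_le_diam hx hy) hu)

theorem le_diam_append (h : HasBoundedDistortion φ E C b c) (u v : List ι) :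
    pieceDiam φ E u * pieceDiam φ E v ≤ C * pieceDiam φ E (u ++ v) := by
  have hu := h.diam_pos u
  rw [mul_comm, ← le_div_iff₀ hu]
  refine Metric.diam_le_of_forall_dist_le
    (div_nonneg (mul_nonneg h.C_pos.le (h.diam_pos _).le) hu.le) ?_
  intro x hx y hy
  rw [le_div_iff₀ hu, mul_comm]
  refine (h.le_dist u x y).trans (mul_le_mul_of_nonneg_left ?_ h.C_pos.le)
  refine h.dist_le_diam ?_ ?_ <;> rw [pieces_append]
  exacts [⟨x, hx, rfl⟩, ⟨y, hy, rfl⟩]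

theorem le_diam_of_ne_nil (h : HasBoundedDistortion φ E C b c) {w : List ι} (hw : w ≠ []) :
    b * pieceDiam φ E w.dropLast ≤ pieceDiam φ E w := by
  conv_rhs => rw [← List.dropLast_concat_getLast hw]
  exact h.le_concat _ _

theorem pow_mul_le_diam (h : HasBoundedDistortion φ E C b c) (w : List ι) :
    b ^ w.length * pieceDiam φ E [] ≤ pieceDiam φ E w := by
  induction w using List.reverseRecOn with
  | nil => simp
  | append_singleton w i ih =>
    refine le_trans ?_ (h.le_concat w i)
    rw [List.length_append, List.length_singleton, pow_succ, mul_comm _ b, mul_assoc]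
    exact mul_le_mul_of_nonneg_left ih h.b_pos.le

theorem exists_length_diam_lt (h : HasBoundedDistortion φ E C b c) {r : ℝ} (hr : 0 < r) :
    ∃ n : ℕ, ∀ w : List ι, n ≤ w.length → pieceDiam φ E w < r := by
  have h0 := h.diam_pos []
  obtain ⟨n, hn⟩ := exists_pow_lt_of_lt_one (div_pos hr h0) h.c_lt_one
  refine ⟨n, fun w hw => (h.diam_le w).trans_lt ?_⟩
  rw [lt_div_iff₀ h0] at hn
  refine lt_of_le_of_lt ?_ hn
  exact mul_le_mul_of_nonneg_right (pow_le_pow_of_le_one h.c_pos.le h.c_lt_one.le hw) h0.le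

/-! ### Stopping words -/

theorem le_diam_of_mem_stoppingWords (h : HasBoundedDistortion φ E C b c) {r : ℝ} {w : List ι}
    (hw : w ∈ stoppingWords (pieces φ E) r) : b * r ≤ pieceDiam φ E w :=
  (mul_le_mul_of_nonneg_left hw.2.2.le h.b_pos.le).trans (h.le_diam_of_ne_nil hw.1)

theorem eq_of_prefix_of_mem_stoppingWords (h : HasBoundedDistortion φ E C b c) {r : ℝ}
    {v w : List ι} (hv : v ∈ stoppingWords (pieces φ E) r)
    (hw : w ∈ stoppingWords (pieces φ E) r) (hvw : v <+: w) : v = w := by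
  rw [← List.dropLast_concat_getLast hw.1, List.prefix_concat_iff,
    List.dropLast_concat_getLast hw.1] at hvw
  rcases hvw with h1 | h1
  · exact h1
  · exact absurd (h.diam_mono h1) (not_le.2 (hv.2.1.trans_lt hw.2.2))

theorem incomparable_of_mem_stoppingWords (h : HasBoundedDistortion φ E C b c) {r : ℝ}
    {v w : List ι} (hv : v ∈ stoppingWords (pieces φ E) r)
    (hw : w ∈ stoppingWords (pieces φ E) r) (hvw : v ≠ w) : Incomparable v w :=
  ⟨fun h1 => hvw (h.eq_of_prefix_of_mem_stoppingWords hv hw h1),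
    fun h1 => hvw (h.eq_of_prefix_of_mem_stoppingWords hw hv h1).symm⟩

theorem exists_stoppingWord_extending (h : HasBoundedDistortion φ E C b c) {r : ℝ} (hr : 0 < r)
    {u : List ι} (hu : r < pieceDiam φ E u) {x : M} (hx : x ∈ pieces φ E u) :
    ∃ v, u <+: v ∧ v ∈ stoppingWords (pieces φ E) r ∧ x ∈ pieces φ E v := by
  classical
  have hex : ∃ n : ℕ, ∃ v : List ι, v.length = n ∧ x ∈ pieces φ E (u ++ v) ∧
      pieceDiam φ E (u ++ v) ≤ r := by
    obtain ⟨n, hn⟩ := h.exists_length_diam_lt hr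
    obtain ⟨v, hv, hxv⟩ := h.invariant.exists_mem_pieces_append hx n
    exact ⟨n, v, hv, hxv, (hn _ (by simp [hv])).le⟩
  obtain ⟨v, hv, hxv, hdv⟩ := Nat.find_spec hex
  have hv0 : v ≠ [] := by
    rintro rfl
    rw [List.append_nil] at hdv
    exact absurd hu (not_lt.2 hdv)
  refine ⟨u ++ v, List.prefix_append u v, ⟨by simp [hv0], hdv, ?_⟩, hxv⟩
  by_contra hle
  -- otherwise the parent would have been a shorter choice
  rw [not_lt, List.dropLast_append_of_ne_nil hv0] at hle
  refine Nat.find_min hex (m := v.dropLast.length) ?_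
    ⟨v.dropLast, rfl, h.invariant.pieces_subset_of_prefix ?_ hxv, hle⟩
  · rw [← hv, List.length_dropLast]
    have := List.length_pos_of_ne_nil hv0
    omega
  · rw [List.prefix_append_right_inj]
    exact List.dropLast_prefix v

theorem exists_stoppingWord_prefix {r : ℝ} {w : List ι} (hw : pieceDiam φ E w ≤ r)
    (hr : r < pieceDiam φ E []) :
    ∃ v, v <+: w ∧ v ∈ stoppingWords (pieces φ E) r := by
  induction w using List.reverseRecOn with
  | nil => exact absurd hr (not_lt.2 hw)
  | append_singleton w i ih =>
    by_cases hwr : pieceDiam φ E w ≤ r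
    · obtain ⟨v, hv, hvr⟩ := ih hwr
      exact ⟨v, hv.trans (List.prefix_append _ _), hvr⟩
    · refine ⟨w ++ [i], List.prefix_rfl, by simp, hw, ?_⟩
      rw [List.dropLast_concat]
      exact not_le.1 hwr

/-! ### Weak control and bounded distortion -/

/-- The images of the invariant set form a weakly controlled Moran construction. -/
theorem isWCMC [Nonempty ι] (h : HasBoundedDistortion φ E C b c) : IsWCMC (pieces φ E) := by
  refine ⟨fun i => ⟨h.isCompact i, h.diam_pos i⟩, max C b⁻¹, le_max_of_le_left h.one_le,
    fun i _ => h.invariant.pieces_subset_of_prefix (List.dropLast_prefix i), ?_, ?_, ?_⟩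
  · have : 0 < (max C b⁻¹)⁻¹ := inv_pos.2 (lt_max_of_lt_left h.C_pos)
    obtain ⟨n, hn⟩ := h.exists_length_diam_lt this
    exact ⟨n + 1, by omega, fun i hi => hn i (by omega)⟩
  · intro i j _ _
    refine (h.diam_append_le i j).trans ?_
    have h1 := h.diam_pos i
    have h2 := h.diam_pos j
    exact mul_le_mul_of_nonneg_right (mul_le_mul_of_nonneg_right (le_max_left _ _) h1.le) h2.le
  · intro i hi
    refine le_trans (mul_le_mul_of_nonneg_right ?_ (h.diam_pos _).le) (h.le_diam_of_ne_nil hi)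
    exact inv_le_of_inv_le₀ h.b_pos (le_max_right _ _)

end HasBoundedDistortion

/-- A semiconformal iterated function system has bounded distortion: the ratio bounds of a word are
comparable with the diameter of its piece. -/
theorem IsSemiconformal.exists_hasBoundedDistortion [Fintype ι] [Nonempty ι] (hφ : IsIFS φ)
    (hE : IsInvariantSet φ E) (hsc : IsSemiconformal φ E) :
    ∃ C b c : ℝ, HasBoundedDistortion φ E C b c := by
  obtain ⟨hΔ, D, sL, sU, hD, hs⟩ := hsc
  set Δ := Metric.diam E with hΔdef
  have hD0 : 0 < D := zero_lt_one.trans_le hD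
  have hbd := hE.2.1.isBounded
  have hnil : pieceDiam φ E [] = Δ := by rw [pieceDiam, pieces_nil]
  have hup : ∀ w ≠ [], pieceDiam φ E w ≤ sU w * Δ := by
    intro w hw
    obtain ⟨h1, h2, -, -, h5⟩ := hs w hw
    refine Metric.diam_le_of_forall_dist_le (mul_nonneg (h1.le.trans h2) hΔ.le) ?_
    rintro _ ⟨x, hx, rfl⟩ _ ⟨y, hy, rfl⟩
    exact (h5 x y).2.trans (mul_le_mul_of_nonneg_left (Metric.dist_le_diam_of_mem hbd hx hy)
      (h1.le.trans h2))
  have hcont : ∀ w ≠ [], Continuous (wordMap φ w) := by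
    intro w hw
    obtain ⟨h1, h2, -, -, h5⟩ := hs w hw
    exact (LipschitzWith.of_dist_le_mul (K := (sU w).toNNReal) fun x y => by
      rw [Real.coe_toNNReal _ (h1.le.trans h2)]
      exact (h5 x y).2).continuous
  have hlow : ∀ w ≠ [], sL w * Δ ≤ pieceDiam φ E w := by
    intro w hw
    obtain ⟨h1, h2, -, -, h5⟩ := hs w hw
    rw [mul_comm, ← le_div_iff₀ h1]
    refine Metric.diam_le_of_forall_dist_le (div_nonneg Metric.diam_nonneg h1.le) ?_
    intro x hx y hy
    rw [le_div_iff₀ h1, mul_comm]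
    exact (h5 x y).1.trans (Metric.dist_le_diam_of_mem (hE.2.1.image (hcont w hw)).isBounded
      ⟨x, hx, rfl⟩ ⟨y, hy, rfl⟩)
  have hpos : ∀ w, 0 < pieceDiam φ E w := by
    intro w
    by_cases hw : w = []
    · rw [hw, hnil]; exact hΔ
    · exact (mul_pos (hs w hw).1 hΔ).trans_le (hlow w hw)
  -- the two summands serve the nonempty words and the empty word
  set C := 1 + D * Δ + D / Δ with hC
  have hDΔ : 0 < D * Δ := mul_pos hD0 hΔ
  have hDΔ' : 0 < D / Δ := div_pos hD0 hΔ
  have hC0 : 0 < C := by positivity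
  have hle : ∀ w x y, pieceDiam φ E w * dist x y ≤ C * dist (wordMap φ w x) (wordMap φ w y) := by
    intro w x y
    by_cases hw : w = []
    · subst hw
      rw [hnil]
      refine mul_le_mul_of_nonneg_right ?_ dist_nonneg
      nlinarith
    · obtain ⟨h1, h2, -, h4, h5⟩ := hs w hw
      have := hup w hw
      calc pieceDiam φ E w * dist x y ≤ (sU w * Δ) * dist x y :=
            mul_le_mul_of_nonneg_right this dist_nonneg
        _ ≤ (D * sL w * Δ) * dist x y := by gcongr
        _ = D * Δ * (sL w * dist x y) := by ring
        _ ≤ C * dist (wordMap φ w x) (wordMap φ w y) :=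
            mul_le_mul (by linarith) (h5 x y).1 (mul_nonneg h1.le dist_nonneg) hC0.le
  have hge : ∀ w x y, dist (wordMap φ w x) (wordMap φ w y) ≤ C * pieceDiam φ E w * dist x y := by
    intro w x y
    by_cases hw : w = []
    · subst hw
      rw [hnil]
      have h1 : 1 ≤ C * Δ := by
        have : D / Δ * Δ = D := by field_simp
        nlinarith
      simpa [wordMap] using mul_le_mul_of_nonneg_right h1 (dist_nonneg (x := x) (y := y))
    · obtain ⟨h1, h2, -, h4, h5⟩ := hs w hw
      refine (h5 x y).2.trans (mul_le_mul_of_nonneg_right ?_ dist_nonneg)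
      calc sU w ≤ D * sL w := h4
        _ = D / Δ * (sL w * Δ) := by field_simp
        _ ≤ C * pieceDiam φ E w :=
            mul_le_mul (by linarith) (hlow w hw) (mul_nonneg h1.le hΔ.le) hC0.le
  choose hinj s hs0 hs1 hsd using hφ
  obtain ⟨c, hc0, hc1, hc⟩ : ∃ c : ℝ, 0 < c ∧ c < 1 ∧ ∀ i, s i ≤ c := by
    obtain ⟨i, hi⟩ := Finite.exists_max s
    exact ⟨s i, hs0 i, hs1 i, hi⟩
  have hlip : ∀ (w : List ι) x y, dist (wordMap φ w x) (wordMap φ w y) ≤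
      c ^ w.length * dist x y := by
    intro w x y
    induction w with
    | nil => simp [wordMap]
    | cons a w ih =>
      simp only [wordMap, Function.comp, List.length_cons]
      calc _ ≤ s a * dist (wordMap φ w x) (wordMap φ w y) := hsd a _ _
        _ ≤ c * (c ^ w.length * dist x y) := mul_le_mul (hc a) ih dist_nonneg hc0.le
        _ = c ^ (w.length + 1) * dist x y := by ring
  obtain ⟨b, hb0, hb⟩ : ∃ b : ℝ, 0 < b ∧ ∀ i, b ≤ C⁻¹ * pieceDiam φ E [i] := by
    obtain ⟨i, hi⟩ := Finite.exists_min fun i => C⁻¹ * pieceDiam φ E [i]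
    exact ⟨_, mul_pos (inv_pos.2 hC0) (hpos [i]), hi⟩
  refine ⟨C, b, c, hE, by linarith, hb0, hc0, hc1, hpos, hle, hge, ?_, ?_⟩
  · intro w i
    have hw := hpos w
    refine (mul_le_mul_of_nonneg_right (hb i) hw.le).trans ?_
    rw [mul_assoc, inv_mul_le_iff₀ hC0, ← le_div_iff₀ hw]
    refine Metric.diam_le_of_forall_dist_le (div_nonneg (mul_pos hC0 (hpos _)).le hw.le) ?_
    intro x hx y hy
    rw [le_div_iff₀ hw, mul_comm]
    refine (hle w x y).trans (mul_le_mul_of_nonneg_left ?_ hC0.le)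
    refine Metric.dist_le_diam_of_mem ?_ ?_ ?_
    · exact (hE.2.1.image (hcont _ (by simp))).isBounded
    all_goals rw [pieces_append]
    exacts [⟨x, hx, rfl⟩, ⟨y, hy, rfl⟩]
  · intro w
    rw [hnil]
    refine Metric.diam_le_of_forall_dist_le (by positivity) ?_
    rintro _ ⟨x, hx, rfl⟩ _ ⟨y, hy, rfl⟩
    exact (hlip w x y).trans (mul_le_mul_of_nonneg_left
      (Metric.dist_le_diam_of_mem hbd hx hy) (by positivity))

end MoranIFS

namespace MoranIFS

variable {ι M : Type*} [MetricSpace M] {φ : ι → M → M} {E : Set M} {C b c : ℝ}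

/-! ### Clusters of pieces -/

/-- A cluster around the word `k`: a finite family of pairwise incomparable words whose pieces are
more than four times as large as the piece of `k` and come within its diameter of that piece. The
requirement is imposed after composition with an arbitrary word `u`, which makes the notion
invariant under the system, so that no constants are lost when clusters are transported. -/
def IsCluster (φ : ι → M → M) (E : Set M) (k : List ι) (F : Finset (List ι)) : Prop :=
  (∀ v ∈ F, ∀ w ∈ F, v ≠ w → Incomparable v w) ∧
  ∀ u : List ι, ∀ w ∈ F, 4 * pieceDiam φ E (u ++ k) < pieceDiam φ E (u ++ w) ∧
    ∃ x ∈ pieces φ E (u ++ w), ∃ y ∈ pieces φ E (u ++ k), dist x y ≤ pieceDiam φ E (u ++ k)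

/-- If a word `l` incomparable with `j` has a piece close to that of `j ++ k`, then the images under
`j` of the members of a cluster around `k`, together with `l`, form a cluster around `j ++ k`. -/
theorem HasBoundedDistortion.isCluster_insert [DecidableEq (List ι)]
    (h : HasBoundedDistortion φ E C b c)
    {k j l : List ι} {F : Finset (List ι)} (hF : IsCluster φ E k F)
    (hk : 4 * C ^ 3 * pieceDiam φ E k < b)
    (hlj : Incomparable l j) (hl : b * pieceDiam φ E j ≤ pieceDiam φ E l)
    {x y : M} (hx : x ∈ pieces φ E l) (hy : y ∈ pieces φ E (j ++ k))
    (hxy : C ^ 2 * dist x y ≤ pieceDiam φ E (j ++ k)) :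
    IsCluster φ E (j ++ k) (insert l (F.image (j ++ ·))) := by
  have hC := h.C_pos
  have hlF : ∀ f, Incomparable l (j ++ f) := fun f =>
    hlj.mono List.prefix_rfl (List.prefix_append j f)
  constructor
  · intro v hv w hw hvw
    rw [Finset.mem_insert, Finset.mem_image] at hv hw
    rcases hv with rfl | ⟨v, hv, rfl⟩ <;> rcases hw with rfl | ⟨w, hw, rfl⟩
    · exact absurd rfl hvw
    · exact hlF w
    · exact (hlF v).symm
    · rw [incomparable_append_left]
      exact hF.1 v hv w hw fun hh => hvw (by rw [hh])
  · intro u w hw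
    rw [Finset.mem_insert, Finset.mem_image] at hw
    rcases hw with rfl | ⟨w, hw, rfl⟩
    · have hu := h.diam_pos u
      have hj := h.diam_pos j
      constructor
      · have h1 := h.diam_append_le u (j ++ k)
        have h2 := h.diam_append_le j k
        have h3 := h.le_diam_append u w
        refine lt_of_mul_lt_mul_left ?_ hC.le
        calc C * (4 * pieceDiam φ E (u ++ (j ++ k)))
            ≤ C * (4 * (C * pieceDiam φ E u * (C * pieceDiam φ E j * pieceDiam φ E k))) := by
              gcongr
              exact h1.trans (by gcongr)
          _ = (4 * C ^ 3 * pieceDiam φ E k) * (pieceDiam φ E u * pieceDiam φ E j) := by ring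
          _ < b * (pieceDiam φ E u * pieceDiam φ E j) := by gcongr
          _ = pieceDiam φ E u * (b * pieceDiam φ E j) := by ring
          _ ≤ pieceDiam φ E u * pieceDiam φ E w := by gcongr
          _ ≤ _ := h3
      · refine ⟨wordMap φ u x, ?_, wordMap φ u y, ?_, ?_⟩
        · rw [pieces_append]; exact ⟨x, hx, rfl⟩
        · rw [pieces_append]; exact ⟨y, hy, rfl⟩
        · refine le_of_mul_le_mul_left ?_ hC
          calc C * dist (wordMap φ u x) (wordMap φ u y)
              ≤ C * (C * pieceDiam φ E u * dist x y) := by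
                gcongr
                exact h.dist_le u x y
            _ = pieceDiam φ E u * (C ^ 2 * dist x y) := by ring
            _ ≤ pieceDiam φ E u * pieceDiam φ E (j ++ k) := by gcongr
            _ ≤ _ := h.le_diam_append u _
    · have := hF.2 (u ++ j) w hw
      simpa only [List.append_assoc] using this

/-- If every word `k` has, after composition with some word `j`, a piece of a word incomparable with
`j` close to it, then there are arbitrarily large clusters. -/
theorem HasBoundedDistortion.exists_isCluster [Nonempty ι] (h : HasBoundedDistortion φ E C b c)
    (H : ∀ k : List ι, ∃ j l, Incomparable l j ∧ b * pieceDiam φ E j ≤ pieceDiam φ E l ∧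
      ∃ x ∈ pieces φ E l, ∃ y ∈ pieces φ E (j ++ k), C ^ 2 * dist x y ≤ pieceDiam φ E (j ++ k))
    (m : ℕ) : ∃ k F, F.card = m ∧ IsCluster φ E k F := by
  classical
  have hC := h.C_pos
  suffices ∃ k F, F.card = m ∧ IsCluster φ E k F ∧
      ∀ u, 4 * C ^ 3 * pieceDiam φ E (u ++ k) < b by
    obtain ⟨k, F, h1, h2, -⟩ := this
    exact ⟨k, F, h1, h2⟩
  induction m with
  | zero =>
    have hC3 : 0 < 4 * C ^ 3 := by positivity
    obtain ⟨n, hn⟩ := h.exists_length_diam_lt (div_pos h.b_pos hC3)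
    refine ⟨List.replicate n (Classical.arbitrary ι), ∅, rfl, ⟨by simp, by simp⟩, fun u => ?_⟩
    rw [mul_comm, ← lt_div_iff₀ hC3]
    exact hn _ (by simp)
  | succ m ih =>
    obtain ⟨k, F, hm, hF, hk⟩ := ih
    obtain ⟨j, l, hlj, hl, x, hx, y, hy, hxy⟩ := H k
    refine ⟨j ++ k, _, ?_, h.isCluster_insert hF (hk []) hlj hl hx hy hxy, fun u => ?_⟩
    · rw [Finset.card_insert_of_notMem,
        Finset.card_image_of_injective _ (List.append_right_injective j), hm]
      rw [Finset.mem_image]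
      rintro ⟨f, -, rfl⟩
      exact hlj.2 (List.prefix_append j f)
    · rw [← List.append_assoc]
      exact hk _

/-- If, at all scales, the pieces of `j ++ k` stay away from those of all words incomparable with
`j`, then a small ball around a point of the piece of `k` is feasible. -/
theorem HasBoundedDistortion.strongOpenSetCondition_of_separated
    (h : HasBoundedDistortion φ E C b c) {k : List ι}
    (H : ∀ j l, Incomparable l j → b * pieceDiam φ E j ≤ pieceDiam φ E l →
      ∀ x ∈ pieces φ E l, ∀ y ∈ pieces φ E (j ++ k),
        pieceDiam φ E (j ++ k) < C ^ 2 * dist x y) :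
    StrongOpenSetCondition φ E := by
  have hC := h.C_pos
  have hk := h.diam_pos k
  obtain ⟨y, hy⟩ := h.nonempty k
  have hyE := h.invariant.pieces_subset k hy
  have hη : 0 < pieceDiam φ E k / (2 * C ^ 4) := by positivity
  refine ⟨Metric.ball y (pieceDiam φ E k / (2 * C ^ 4)), ⟨⟨y, Metric.mem_ball_self hη⟩,
    Metric.isOpen_ball, ?_⟩, ⟨y, Metric.mem_ball_self hη, hyE⟩⟩
  have key : ∀ i i', Incomparable i i' → pieceDiam φ E i * pieceDiam φ E k <
      C ^ 3 * dist (wordMap φ i y) (wordMap φ i' y) := by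
    intro i i' hii
    obtain ⟨p, hp0, hpi', hpi, hpd⟩ := hii.exists_prefix
    have h1 := H i p hpi
      ((mul_le_mul_of_nonneg_left (h.diam_mono hpd) h.b_pos.le).trans (h.le_diam_of_ne_nil hp0))
      (wordMap φ i' y) (h.invariant.pieces_subset_of_prefix hpi' ⟨y, hyE, rfl⟩)
      (wordMap φ i y) (by rw [pieces_append]; exact ⟨y, hy, rfl⟩)
    calc _ ≤ C * pieceDiam φ E (i ++ k) := h.le_diam_append i k
      _ < C * (C ^ 2 * dist (wordMap φ i' y) (wordMap φ i y)) := by gcongr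
      _ = _ := by rw [dist_comm]; ring
  intro i j hij
  rw [Set.disjoint_left]
  rintro _ ⟨u, hu, rfl⟩ ⟨v, hv, hvu⟩
  have h1 := key i j hij
  have h2 := key j i hij.symm
  rw [dist_comm (wordMap φ j y)] at h2
  have h3 : dist (wordMap φ i y) (wordMap φ j y) ≤
      dist (wordMap φ i u) (wordMap φ i y) + dist (wordMap φ j v) (wordMap φ j y) := by
    rw [hvu, dist_comm (wordMap φ i u) (wordMap φ i y)]
    exact dist_triangle _ _ _
  have hi := h.diam_pos i
  have hj := h.diam_pos j
  rw [Metric.mem_ball, lt_div_iff₀ (by positivity)] at hu hv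
  have h4 := mul_le_mul_of_nonneg_left (h.dist_le i u y) (show 0 ≤ 2 * C ^ 3 by positivity)
  have h5 := mul_le_mul_of_nonneg_left (h.dist_le j v y) (show 0 ≤ 2 * C ^ 3 by positivity)
  have h6 := mul_lt_mul_of_pos_left hu hi
  have h7 := mul_lt_mul_of_pos_left hv hj
  have h8 := mul_le_mul_of_nonneg_left h3 (show 0 ≤ 2 * C ^ 3 by positivity)
  linarith

/-- If the clusters are bounded in size, then the strong open set condition holds. -/
theorem HasBoundedDistortion.strongOpenSetCondition_of_isCluster_card_le [Nonempty ι]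
    (h : HasBoundedDistortion φ E C b c)
    (H : ∃ N : ℕ, ∀ k F, IsCluster φ E k F → F.card ≤ N) : StrongOpenSetCondition φ E := by
  by_contra hno
  obtain ⟨N, hN⟩ := H
  obtain ⟨k, F, hF, hkF⟩ := h.exists_isCluster (fun k => by
    by_contra hk
    push Not at hk
    exact hno (h.strongOpenSetCondition_of_separated hk)) (N + 1)
  have := hN k F hkF
  omega

/-! ### Doubling and the ball condition -/

theorem IsDoubling.exists_cover {κ : ℕ}
    (hκ : ∀ (x : M) (r : ℝ), 0 < r →
      ∃ s : Finset M, s.card ≤ κ ∧ Metric.ball x (2 * r) ⊆ ⋃ y ∈ s, Metric.ball y r)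
    (n : ℕ) (x : M) {r : ℝ} (hr : 0 < r) :
    ∃ s : Finset M, s.card ≤ κ ^ n ∧ Metric.ball x (2 ^ n * r) ⊆ ⋃ y ∈ s, Metric.ball y r := by
  classical
  induction n generalizing x with
  | zero => exact ⟨{x}, by simp, by simp⟩
  | succ n ih =>
    obtain ⟨s, hs, hxs⟩ := hκ x (2 ^ n * r) (by positivity)
    choose t ht hyt using ih
    refine ⟨s.biUnion t, ?_, ?_⟩
    · refine (Finset.card_biUnion_le_card_mul s t _ fun y _ => ht y).trans ?_
      rw [pow_succ, mul_comm]
      exact Nat.mul_le_mul_left _ hs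
    · intro z hz
      rw [pow_succ, mul_comm _ (2 : ℝ), mul_assoc] at hz
      obtain ⟨y, hy, hzy⟩ := mem_iUnion₂.1 (hxs hz)
      obtain ⟨w, hw, hzw⟩ := mem_iUnion₂.1 (hyt y hzy)
      exact mem_iUnion₂.2 ⟨w, Finset.mem_biUnion.2 ⟨y, hy, hw⟩, hzw⟩

/-- In a doubling space, a ball contains boundedly many centres of disjoint balls of comparable
radius. -/
theorem IsDoubling.exists_card_le (hM : IsDoubling M) {δ : ℝ} (hδ : 0 < δ) :
    ∃ N : ℕ, ∀ (x : M) (r : ℝ), 0 < r → ∀ (T : Finset (List ι)) (p : List ι → M),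
      (∀ i ∈ T, p i ∈ Metric.ball x (4 * r)) →
      (T : Set (List ι)).PairwiseDisjoint (fun i => Metric.ball (p i) (δ * r)) → T.card ≤ N := by
  obtain ⟨κ, hκ⟩ := hM
  obtain ⟨n, hn⟩ := pow_unbounded_of_one_lt (8 / δ) (one_lt_two (α := ℝ))
  refine ⟨κ ^ n, fun x r hr T p hp hd => ?_⟩
  obtain ⟨s, hs, hxs⟩ := exists_cover hκ n x (r := δ * r / 2) (by positivity)
  have hcov : ∀ i ∈ T, ∃ y ∈ s, p i ∈ Metric.ball y (δ * r / 2) := by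
    intro i hi
    have h1 : p i ∈ Metric.ball x (2 ^ n * (δ * r / 2)) := by
      refine Metric.ball_subset_ball ?_ (hp i hi)
      rw [div_lt_iff₀ hδ] at hn
      nlinarith
    simpa using hxs h1
  have : Nonempty M := ⟨x⟩
  choose! q hqs hq using hcov
  refine le_trans (Finset.card_le_card_of_injOn q hqs ?_) hs
  intro i hi j hj hij
  by_contra hne
  have h1 := hq i hi
  have h2 := hq j hj
  rw [← hij] at h2
  have h3 : p j ∈ Metric.ball (p i) (δ * r) := by
    rw [Metric.mem_ball] at *
    have := dist_triangle_right (p j) (p i) (q i)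
    linarith
  exact Set.disjoint_left.1 (hd hi hj hne) h3 (Metric.mem_ball_self (by positivity))

/-- The requirement of the ball condition at the point `x` and the scale `r`, with constant `δ`. -/
def HasBallsAt (X : List ι → Set M) (δ : ℝ) (x : M) (r : ℝ) : Prop :=
  ∃ p : List ι → M,
    (∀ i ∈ stoppingWordsAt X x r, Metric.infDist (p i) (X i) < r) ∧
    (stoppingWordsAt X x r).PairwiseDisjoint fun i => Metric.ball (p i) (δ * r)

theorem HasBoundedDistortion.exists_card_stoppingWordsAt_le (h : HasBoundedDistortion φ E C b c)
    (hM : IsDoubling M) {δ : ℝ} (hδ : 0 < δ) :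
    ∃ N : ℕ, ∀ (x : M) (r : ℝ), 0 < r → HasBallsAt (pieces φ E) δ x r →
      ∀ T : Finset (List ι), (T : Set (List ι)) ⊆ stoppingWordsAt (pieces φ E) x r →
        T.card ≤ N := by
  obtain ⟨N, hN⟩ := hM.exists_card_le (ι := ι) hδ
  refine ⟨N, fun x r hr ⟨p, hp, hpd⟩ T hT => hN x r hr T p (fun i hi => ?_) (hpd.subset hT)⟩
  obtain ⟨hi1, z, hz, hzx⟩ := hT hi
  obtain ⟨y, hy, hpy⟩ := (Metric.infDist_lt_iff (h.nonempty i)).1 (hp i (hT hi))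
  have h1 := (h.dist_le_diam hy hz).trans hi1.2.1
  rw [Metric.mem_ball] at *
  have := dist_triangle4 (p i) y z x
  linarith

/-- Under the ball condition clusters are bounded in size: a cluster around `k` reappears at
arbitrarily small scales at the fixed point of the map of `k`. -/
theorem HasBoundedDistortion.isCluster_card_le_of_moranBallCondition
    (h : HasBoundedDistortion φ E C b c) (hM : IsDoubling M)
    (hball : MoranBallCondition (pieces φ E)) :
    ∃ N : ℕ, ∀ k F, IsCluster φ E k F → F.card ≤ N := by
  classical
  obtain ⟨δ, hδ, -, hB⟩ := hball
  obtain ⟨N, hN⟩ := h.exists_card_stoppingWordsAt_le hM hδ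
  refine ⟨N, fun k F hF => ?_⟩
  rcases F.eq_empty_or_nonempty with rfl | ⟨w₀, hw₀⟩
  · simp
  have hk0 : k ≠ [] := by
    rintro rfl
    have h1 := (hF.2 [] w₀ hw₀).1
    have h2 := h.diam_mono (List.nil_prefix (l := w₀))
    have h3 := h.diam_pos []
    simp only [List.nil_append] at h1
    linarith
  let u : ℕ → List ι := fun n => (List.replicate n k).flatten
  have hu : ∀ n, u (n + 1) = u n ++ k := by
    intro n
    simp [u, List.replicate_succ']
  obtain ⟨x, hx⟩ : (⋂ n, pieces φ E (u n)).Nonempty := by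
    refine IsCompact.nonempty_iInter_of_sequence_nonempty_isCompact_isClosed _ (fun n => ?_)
      (fun n => h.nonempty _) (h.isCompact _) fun n => (h.isCompact _).isClosed
    rw [hu]
    exact h.invariant.pieces_append_subset _ _
  rw [mem_iInter] at hx
  obtain ⟨R, hR, hBx⟩ := hB x (h.invariant.subset_limitSet (h.invariant.pieces_subset _ (hx 0)))
  have hR3 : 0 < R / 3 := by positivity
  obtain ⟨n, hn⟩ := h.exists_length_diam_lt hR3
  have hlen : n ≤ (u n ++ k).length := by
    have : n * 1 ≤ n * k.length := Nat.mul_le_mul_left n (List.length_pos_of_ne_nil hk0)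
    simp only [u, List.length_append, List.length_flatten, List.map_replicate,
      List.sum_replicate, smul_eq_mul]
    omega
  have hsmall := hn _ hlen
  set ρ := pieceDiam φ E (u n ++ k) with hρ
  have hρ0 : 0 < ρ := h.diam_pos _
  have hxk : x ∈ pieces φ E (u n ++ k) := by rw [← hu]; exact hx _
  -- each member of the transported cluster contains a stopping word at scale `3 * ρ`
  have hext : ∀ w ∈ F, ∃ v, u n ++ w <+: v ∧ v ∈ stoppingWordsAt (pieces φ E) x (3 * ρ) := by
    intro w hw
    obtain ⟨h1, z, hz, y, hy, hzy⟩ := hF.2 (u n) w hw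
    obtain ⟨v, hv, hvr, hzv⟩ := h.exists_stoppingWord_extending (r := 3 * ρ) (by positivity)
      (by linarith) hz
    refine ⟨v, hv, hvr, z, hzv, ?_⟩
    rw [Metric.mem_ball]
    have := dist_triangle z y x
    have := h.dist_le_diam hy hxk
    linarith
  choose! v hv hvx using hext
  have hinj : Set.InjOn v F := by
    intro w hw w' hw' hww
    by_contra hne
    have h1 := hF.1 w hw w' hw' hne
    rw [← incomparable_append_left (u n)] at h1
    exact (h1.mono (hv w hw) (hv w' hw')).ne hww
  rw [← Finset.card_image_of_injOn hinj]
  refine hN x (3 * ρ) (by positivity) (hBx _ (by positivity) (by linarith)) _ ?_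
  intro w hw
  obtain ⟨w', hw', rfl⟩ := Finset.mem_image.1 hw
  exact hvx w' hw'

end MoranIFS

namespace MoranIFS

/-! ### Almost multiplicative sequences -/

section AlmostMultiplicative

variable {a : ℕ → ℝ} {K : ℝ}

theorem subadditive_log_add (ha : ∀ n, 0 < a n) (hK : 1 ≤ K)
    (h1 : ∀ m n, a (m + n) ≤ K * (a m * a n)) :
    Subadditive fun n => Real.log (a n) + Real.log K := by
  intro m n
  have hK0 : 0 < K := by linarith
  have := Real.log_le_log (ha _) (h1 m n)
  rw [Real.log_mul hK0.ne' (mul_pos (ha m) (ha n)).ne', Real.log_mul (ha m).ne' (ha n).ne'] at this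
  linarith

theorem subadditive_sub_log (ha : ∀ n, 0 < a n) (hK : 1 ≤ K)
    (h2 : ∀ m n, a m * a n ≤ K * a (m + n)) :
    Subadditive fun n => Real.log K - Real.log (a n) := by
  intro m n
  have hK0 : 0 < K := by linarith
  have := Real.log_le_log (mul_pos (ha m) (ha n)) (h2 m n)
  rw [Real.log_mul hK0.ne' (ha _).ne', Real.log_mul (ha m).ne' (ha n).ne'] at this
  linarith

theorem exists_tendsto_log_div (ha : ∀ n, 0 < a n) (hK : 1 ≤ K)
    (h1 : ∀ m n, a (m + n) ≤ K * (a m * a n)) (h2 : ∀ m n, a m * a n ≤ K * a (m + n)) :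
    ∃ p, Tendsto (fun n : ℕ => 1 / (n : ℝ) * Real.log (a n)) atTop (𝓝 p) := by
  have hu := subadditive_log_add ha hK h1
  have hv := subadditive_sub_log ha hK h2
  have hlK := Real.log_nonneg hK
  have hv0 : 0 ≤ Real.log K - Real.log (a 0) := by
    have := hv 0 0
    simp only [add_zero] at this
    linarith
  have hbdd : BddBelow (range fun n : ℕ => (Real.log (a n) + Real.log K) / n) := by
    refine ⟨-|Real.log K - Real.log (a 1)| - (Real.log K - Real.log (a 0)), ?_⟩
    rintro _ ⟨n, rfl⟩
    have habs := le_abs_self (Real.log K - Real.log (a 1))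
    have habs0 := abs_nonneg (Real.log K - Real.log (a 1))
    rcases Nat.eq_zero_or_pos n with rfl | hn
    · simp only [Nat.cast_zero, div_zero]
      linarith
    · have hn1 : (1 : ℝ) ≤ n := by exact_mod_cast hn
      dsimp only
      rw [le_div_iff₀ (by linarith)]
      have := hv.apply_mul_add_le n 1 0
      simp only [mul_one, add_zero] at this
      nlinarith
  refine ⟨hu.lim, ?_⟩
  have h3 := hu.tendsto_lim hbdd
  have h4 : Tendsto (fun n : ℕ => Real.log K / n) atTop (𝓝 0) :=
    tendsto_const_div_atTop_nhds_zero_nat _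
  have h5 := h3.sub h4
  rw [sub_zero] at h5
  exact h5.congr fun n => by ring

/-- An almost multiplicative sequence without exponential growth or decay is bounded above and
bounded away from zero. -/
theorem bounds_of_tendsto_log_div_zero (ha : ∀ n, 0 < a n) (hK : 1 ≤ K)
    (h1 : ∀ m n, a (m + n) ≤ K * (a m * a n)) (h2 : ∀ m n, a m * a n ≤ K * a (m + n))
    (h0 : Tendsto (fun n : ℕ => 1 / (n : ℝ) * Real.log (a n)) atTop (𝓝 0)) (n : ℕ) :
    1 ≤ K * a n ∧ a n ≤ K := by
  have hK0 : 0 < K := by linarith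
  have hu := subadditive_log_add ha hK h1
  have hv := subadditive_sub_log ha hK h2
  have h4 : Tendsto (fun n : ℕ => Real.log K / n) atTop (𝓝 0) :=
    tendsto_const_div_atTop_nhds_zero_nat _
  have hut : Tendsto (fun n : ℕ => (Real.log (a n) + Real.log K) / n) atTop (𝓝 0) := by
    have := h0.add h4
    rw [add_zero] at this
    exact this.congr fun n => by ring
  have hvt : Tendsto (fun n : ℕ => (Real.log K - Real.log (a n)) / n) atTop (𝓝 0) := by
    have := h4.sub h0
    rw [sub_zero] at this
    exact this.congr fun n => by ring
  rcases Nat.eq_zero_or_pos n with rfl | hn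
  · have h5 := h1 0 0
    have h6 := h2 0 0
    have h7 := ha 0
    rw [add_zero] at h5 h6
    constructor <;> nlinarith
  · have hn0 : (0 : ℝ) < n := by exact_mod_cast hn
    constructor
    · have h5 := hu.lim_le_div hut.bddBelow_range hn.ne'
      rw [tendsto_nhds_unique (hu.tendsto_lim hut.bddBelow_range) hut, le_div_iff₀ hn0,
        zero_mul, ← Real.log_mul (ha n).ne' hK0.ne', Real.log_nonneg_iff
          (mul_pos (ha n) hK0)] at h5
      linarith
    · have h5 := hv.lim_le_div hvt.bddBelow_range hn.ne'
      rw [tendsto_nhds_unique (hv.tendsto_lim hvt.bddBelow_range) hvt, le_div_iff₀ hn0,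
        zero_mul, sub_nonneg] at h5
      exact (Real.log_le_log_iff (ha n) hK0).1 h5

end AlmostMultiplicative

/-! ### Pressure -/

variable {ι M : Type*} [Fintype ι] [MetricSpace M] {φ : ι → M → M} {E : Set M} {C b c : ℝ}

/-- The sum of `diam (E_{uv}) ^ t` over the words `v` of length `n`. -/
noncomputable def levelSum (φ : ι → M → M) (E : Set M) (t : ℝ) (n : ℕ) (u : List ι) : ℝ :=
  ∑ v ∈ wordsOfLength ι n, pieceDiam φ E (u ++ v) ^ t

theorem levelSum_add (φ : ι → M → M) (E : Set M) (t : ℝ) (m n : ℕ) (u : List ι) :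
    levelSum φ E t (m + n) u = ∑ v ∈ wordsOfLength ι m, levelSum φ E t n (u ++ v) := by
  simp only [levelSum, sum_wordsOfLength_add, List.append_assoc]

theorem levelSum_zero (φ : ι → M → M) (E : Set M) (t : ℝ) (u : List ι) :
    levelSum φ E t 0 u = pieceDiam φ E u ^ t := by
  simp [levelSum]

theorem hasPressure_iff {t p : ℝ} : HasPressure (pieces φ E) t p ↔
    Tendsto (fun n : ℕ => 1 / (n : ℝ) * Real.log (levelSum φ E t n [])) atTop (𝓝 p) := by
  simp only [HasPressure, levelSum, sum_wordsOfLength, List.nil_append]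

theorem hasPressure_zero (φ : ι → M → M) (E : Set M) :
    HasPressure (pieces φ E) 0 (Real.log (Fintype.card ι)) := by
  refine (tendsto_const_nhds (x := Real.log (Fintype.card ι))).congr' ?_
  filter_upwards [eventually_gt_atTop 0] with n hn
  have hn0 : (n : ℝ) ≠ 0 := by exact_mod_cast hn.ne'
  simp only [Real.rpow_zero, Finset.sum_const, Finset.card_univ, Fintype.card_fun, Fintype.card_fin,
    nsmul_eq_mul, mul_one, Nat.cast_pow, Real.log_pow]
  field_simp

namespace HasBoundedDistortion

theorem levelSum_pos [Nonempty ι] (h : HasBoundedDistortion φ E C b c) (t : ℝ) (n : ℕ)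
    (u : List ι) : 0 < levelSum φ E t n u := by
  refine Finset.sum_pos (fun v _ => Real.rpow_pos_of_pos (h.diam_pos _) t) ?_
  exact ⟨List.replicate n (Classical.arbitrary ι), by simp⟩

theorem levelSum_le (h : HasBoundedDistortion φ E C b c) {t : ℝ} (ht : 0 ≤ t) (n : ℕ)
    (u : List ι) :
    levelSum φ E t n u ≤ C ^ t * (pieceDiam φ E u ^ t * levelSum φ E t n []) := by
  simp only [levelSum, Finset.mul_sum, List.nil_append]
  refine Finset.sum_le_sum fun v _ => ?_
  rw [← mul_assoc, ← Real.mul_rpow h.C_pos.le (h.diam_pos u).le,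
    ← Real.mul_rpow (mul_pos h.C_pos (h.diam_pos u)).le (h.diam_pos v).le]
  exact Real.rpow_le_rpow (h.diam_pos _).le (h.diam_append_le u v) ht

theorem le_levelSum (h : HasBoundedDistortion φ E C b c) {t : ℝ} (ht : 0 ≤ t) (n : ℕ)
    (u : List ι) :
    pieceDiam φ E u ^ t * levelSum φ E t n [] ≤ C ^ t * levelSum φ E t n u := by
  simp only [levelSum, Finset.mul_sum, List.nil_append]
  refine Finset.sum_le_sum fun v _ => ?_
  rw [← Real.mul_rpow (h.diam_pos u).le (h.diam_pos v).le,
    ← Real.mul_rpow h.C_pos.le (h.diam_pos _).le]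
  exact Real.rpow_le_rpow (mul_pos (h.diam_pos u) (h.diam_pos v)).le (h.le_diam_append u v) ht

theorem levelSum_add_le (h : HasBoundedDistortion φ E C b c) {t : ℝ} (ht : 0 ≤ t) (m n : ℕ) :
    levelSum φ E t (m + n) [] ≤ C ^ t * (levelSum φ E t m [] * levelSum φ E t n []) := by
  rw [levelSum_add, levelSum, Finset.sum_mul, Finset.mul_sum]
  exact Finset.sum_le_sum fun v _ => h.levelSum_le ht n _

theorem le_levelSum_add (h : HasBoundedDistortion φ E C b c) {t : ℝ} (ht : 0 ≤ t) (m n : ℕ) :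
    levelSum φ E t m [] * levelSum φ E t n [] ≤ C ^ t * levelSum φ E t (m + n) [] := by
  rw [levelSum_add, levelSum, Finset.sum_mul, Finset.mul_sum]
  exact Finset.sum_le_sum fun v _ => h.le_levelSum ht n _

variable [Nonempty ι]

theorem exists_hasPressure (h : HasBoundedDistortion φ E C b c) {t : ℝ} (ht : 0 ≤ t) :
    ∃ p, HasPressure (pieces φ E) t p := by
  simp only [hasPressure_iff]
  exact exists_tendsto_log_div (fun n => h.levelSum_pos t n []) (Real.one_le_rpow h.one_le ht)
    (h.levelSum_add_le ht) (h.le_levelSum_add ht)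

/-- At the zero of the pressure, the sums of `diam (E_{uv}) ^ t` over words `v` of a given length
are comparable with `diam (E_u) ^ t`. -/
theorem levelSum_bounds (h : HasBoundedDistortion φ E C b c) {t : ℝ} (ht : 0 ≤ t)
    (hp : HasPressure (pieces φ E) t 0) (n : ℕ) (u : List ι) :
    pieceDiam φ E u ^ t ≤ (C ^ t) ^ 2 * levelSum φ E t n u ∧
      levelSum φ E t n u ≤ (C ^ t) ^ 2 * pieceDiam φ E u ^ t := by
  have hK := Real.one_le_rpow h.one_le ht
  obtain ⟨h1, h2⟩ := bounds_of_tendsto_log_div_zero (fun n => h.levelSum_pos t n []) hK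
    (h.levelSum_add_le ht) (h.le_levelSum_add ht) (hasPressure_iff.1 hp) n
  have hd := Real.rpow_pos_of_pos (h.diam_pos u) t
  have h3 := h.levelSum_le ht n u
  have h4 := h.le_levelSum ht n u
  set K := C ^ t
  constructor
  · calc _ ≤ pieceDiam φ E u ^ t * (K * levelSum φ E t n []) := le_mul_of_one_le_right hd.le h1
      _ = K * (pieceDiam φ E u ^ t * levelSum φ E t n []) := by ring
      _ ≤ K * (K * levelSum φ E t n u) := by gcongr
      _ = _ := by ring
  · calc _ ≤ K * (pieceDiam φ E u ^ t * levelSum φ E t n []) := h3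
      _ ≤ K * (pieceDiam φ E u ^ t * K) := by gcongr
      _ = _ := by ring

/-- The pressure is strictly decreasing and Lipschitz continuous. -/
theorem pressure_sub_mem (h : HasBoundedDistortion φ E C b c) {t t' p p' : ℝ} (htt : t ≤ t')
    (hp : HasPressure (pieces φ E) t p) (hp' : HasPressure (pieces φ E) t' p') :
    (t' - t) * Real.log b ≤ p' - p ∧ p' - p ≤ (t' - t) * Real.log c := by
  rw [hasPressure_iff] at hp hp'
  have hsub := hp'.sub hp
  set Δ := pieceDiam φ E [] with hΔ
  have hΔ0 : 0 < Δ := h.diam_pos []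
  have hs : 0 ≤ t' - t := sub_nonneg.2 htt
  have hlim : ∀ x : ℝ, Tendsto (fun n : ℕ => (t' - t) * x + (t' - t) * Real.log Δ / n) atTop
      (𝓝 ((t' - t) * x)) := by
    intro x
    have := (tendsto_const_nhds (x := (t' - t) * x) (f := atTop)).add
      (tendsto_const_div_atTop_nhds_zero_nat ((t' - t) * Real.log Δ))
    rwa [add_zero] at this
  have hmul : ∀ x : ℝ, 0 < x → ∀ n : ℕ, Real.log ((x ^ n * Δ) ^ (t' - t)) =
      (t' - t) * (n * Real.log x + Real.log Δ) := by
    intro x hx n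
    rw [Real.log_rpow (by positivity), Real.log_mul (by positivity) hΔ0.ne', Real.log_pow]
  have hterm : ∀ w, pieceDiam φ E w ^ t' = pieceDiam φ E w ^ t * pieceDiam φ E w ^ (t' - t) := by
    intro w
    rw [← Real.rpow_add (h.diam_pos w), add_sub_cancel]
  have hb := h.b_pos
  have hc := h.c_pos
  have hlow : ∀ n, levelSum φ E t n [] * (b ^ n * Δ) ^ (t' - t) ≤ levelSum φ E t' n [] := by
    intro n
    simp only [levelSum, Finset.sum_mul, hterm]
    refine Finset.sum_le_sum fun w hw => mul_le_mul_of_nonneg_left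
      (Real.rpow_le_rpow (by positivity) ?_ hs) (Real.rpow_pos_of_pos (h.diam_pos _) _).le
    have := h.pow_mul_le_diam w
    rw [mem_wordsOfLength] at hw
    rwa [hw] at this
  have hup : ∀ n, levelSum φ E t' n [] ≤ levelSum φ E t n [] * (c ^ n * Δ) ^ (t' - t) := by
    intro n
    simp only [levelSum, Finset.sum_mul, hterm]
    refine Finset.sum_le_sum fun w hw => mul_le_mul_of_nonneg_left
      (Real.rpow_le_rpow (h.diam_pos _).le ?_ hs) (Real.rpow_pos_of_pos (h.diam_pos _) _).le
    have := h.diam_le w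
    rw [mem_wordsOfLength] at hw
    rwa [hw] at this
  constructor
  · refine le_of_tendsto_of_tendsto (hlim (Real.log b)) hsub ?_
    filter_upwards [eventually_gt_atTop 0] with n hn
    have hn0 : (0 : ℝ) < n := by exact_mod_cast hn
    have h1 := Real.log_le_log (mul_pos (h.levelSum_pos t n [])
      (Real.rpow_pos_of_pos (by positivity) _)) (hlow n)
    rw [Real.log_mul (h.levelSum_pos t n []).ne' (Real.rpow_pos_of_pos (by positivity) _).ne',
      hmul b hb n] at h1
    rw [← mul_sub, one_div, ← div_eq_inv_mul, le_div_iff₀ hn0, add_mul, div_mul_cancel₀ _ hn0.ne']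
    linarith
  · refine le_of_tendsto_of_tendsto hsub (hlim (Real.log c)) ?_
    filter_upwards [eventually_gt_atTop 0] with n hn
    have hn0 : (0 : ℝ) < n := by exact_mod_cast hn
    have h1 := Real.log_le_log (h.levelSum_pos t' n []) (hup n)
    rw [Real.log_mul (h.levelSum_pos t n []).ne' (Real.rpow_pos_of_pos (by positivity) _).ne',
      hmul c hc n] at h1
    rw [← mul_sub, one_div, ← div_eq_inv_mul, div_le_iff₀ hn0, add_mul, div_mul_cancel₀ _ hn0.ne']
    linarith

theorem existsUnique_hasPressure_zero (h : HasBoundedDistortion φ E C b c) :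
    ∃! t : ℝ, 0 ≤ t ∧ HasPressure (pieces φ E) t 0 := by
  have hlc : Real.log c < 0 := Real.log_neg h.c_pos h.c_lt_one
  choose! P hP using fun (t : ℝ) (ht : 0 ≤ t) => h.exists_hasPressure ht
  have hcont : ContinuousOn P (Ici 0) := by
    have hlip : LipschitzOnWith (max |Real.log b| |Real.log c|).toNNReal P (Ici 0) := by
      refine LipschitzOnWith.of_dist_le_mul fun x hx y hy => ?_
      rw [Real.coe_toNNReal _ (le_max_of_le_left (abs_nonneg _))]
      wlog hxy : x ≤ y generalizing x y
      · rw [dist_comm, dist_comm x]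
        exact this y hy x hx (not_le.1 hxy).le
      obtain ⟨h1, h2⟩ := h.pressure_sub_mem hxy (hP x hx) (hP y hy)
      have h3 : 0 ≤ y - x := sub_nonneg.2 hxy
      rw [dist_comm, dist_comm x, Real.dist_eq, Real.dist_eq, abs_of_nonneg h3, abs_le]
      have h4 := (neg_abs_le (Real.log b))
      have h5 := (le_abs_self (Real.log c))
      have h6 := le_max_left |Real.log b| |Real.log c|
      have h7 := le_max_right |Real.log b| |Real.log c|
      constructor <;> nlinarith
    exact hlip.continuousOn
  set T := P 0 / -Real.log c with hT
  have hP0 : 0 ≤ P 0 := by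
    rw [tendsto_nhds_unique (hP 0 le_rfl) (hasPressure_zero φ E)]
    exact Real.log_natCast_nonneg _
  have hT0 : 0 ≤ T := div_nonneg hP0 (by linarith)
  have hPT : P T ≤ 0 := by
    have := (h.pressure_sub_mem hT0 (hP 0 le_rfl) (hP T hT0)).2
    have h1 : T * Real.log c = -P 0 := by
      rw [hT]
      field_simp [hlc.ne]
    linarith
  obtain ⟨t, ⟨ht0, -⟩, ht⟩ := intermediate_value_Icc' hT0 (hcont.mono Icc_subset_Ici_self)
    (show (0 : ℝ) ∈ Icc (P T) (P 0) from ⟨hPT, hP0⟩)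
  refine ⟨t, ⟨ht0, by simpa only [ht] using hP t ht0⟩, ?_⟩
  rintro s ⟨hs0, hs⟩
  have htp : HasPressure (pieces φ E) t 0 := by simpa only [ht] using hP t ht0
  rcases lt_trichotomy s t with hst | hst | hst
  · have := (h.pressure_sub_mem hst.le hs htp).2
    nlinarith
  · exact hst
  · have := (h.pressure_sub_mem hst.le htp hs).2
    nlinarith

end HasBoundedDistortion

theorem pos_of_hasPressure_zero (hι : 2 ≤ Fintype.card ι) {t : ℝ} (ht : 0 ≤ t)
    (hp : HasPressure (pieces φ E) t 0) : 0 < t := by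
  refine lt_of_le_of_ne ht fun h0 => ?_
  subst h0
  have h1 := tendsto_nhds_unique hp (hasPressure_zero φ E)
  have h2 : (1 : ℝ) < Fintype.card ι := by exact_mod_cast hι
  exact (Real.log_pos h2).ne h1

end MoranIFS

namespace MoranIFS

variable {ι M : Type*} [MetricSpace M] {φ : ι → M → M} {E : Set M} {C b c : ℝ}

/-! ### From the open set condition to the ball condition -/

/-- Proper semiconformality makes the maps uniformly open at the points of `W`: around the image of
such a point under a word, a ball of radius proportional to the diameter of the piece is covered
by the image of a given neighbourhood. -/
theorem HasBoundedDistortion.exists_ball_subset_image (h : HasBoundedDistortion φ E C b c)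
    {W : Set M} (hWo : IsOpen W) (hW : W ≠ univ) {x : M} (hx : x ∈ W)
    (hlam : ∃ lam : ℝ, 1 ≤ lam ∧ ∀ i : List ι, i ≠ [] →
      Metric.infDist (wordMap φ i x) (wordMap φ i '' Wᶜ) ≤
        lam * Metric.infDist (wordMap φ i x) (wordMap φ i '' W)ᶜ) {ε : ℝ} (hε : 0 < ε) :
    ∃ ρ : ℝ, 0 < ρ ∧ ∀ i : List ι, i ≠ [] →
      Metric.ball (wordMap φ i x) (ρ * pieceDiam φ E i) ⊆ wordMap φ i '' Metric.ball x ε := by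
  obtain ⟨lam, hlam1, hl⟩ := hlam
  have hlam0 : 0 < lam := by linarith
  have hC := h.C_pos
  have hne : (Wᶜ : Set M).Nonempty := nonempty_compl.2 hW
  set α := Metric.infDist x Wᶜ with hα
  have hα0 : 0 < α :=
    (hWo.isClosed_compl.notMem_iff_infDist_pos hne).1 (by simpa using hx)
  refine ⟨min (α / (C * lam)) (ε / C), lt_min (by positivity) (by positivity), ?_⟩
  intro i hi p hp
  have hd := h.diam_pos i
  rw [Metric.mem_ball] at hp
  have hp1 : dist p (wordMap φ i x) < α / (C * lam) * pieceDiam φ E i :=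
    hp.trans_le (mul_le_mul_of_nonneg_right (min_le_left _ _) hd.le)
  have hp2 : dist p (wordMap φ i x) < ε / C * pieceDiam φ E i :=
    hp.trans_le (mul_le_mul_of_nonneg_right (min_le_right _ _) hd.le)
  have hlow : pieceDiam φ E i * α / C ≤
      Metric.infDist (wordMap φ i x) (wordMap φ i '' Wᶜ) := by
    rw [Metric.le_infDist (hne.image _)]
    rintro _ ⟨y, hy, rfl⟩
    rw [div_le_iff₀ hC, mul_comm _ C]
    refine le_trans ?_ (h.le_dist i x y)
    exact mul_le_mul_of_nonneg_left (Metric.infDist_le_dist_of_mem hy) hd.le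
  have hpW : p ∈ wordMap φ i '' W := by
    by_contra hpW
    have h1 := Metric.infDist_le_dist_of_mem (x := wordMap φ i x)
      (show p ∈ (wordMap φ i '' W)ᶜ from hpW)
    rw [dist_comm] at h1
    have h2 : lam * dist p (wordMap φ i x) < lam * (α / (C * lam) * pieceDiam φ E i) :=
      mul_lt_mul_of_pos_left hp1 hlam0
    have h3 : lam * (α / (C * lam) * pieceDiam φ E i) = pieceDiam φ E i * α / C := by
      field_simp
    have h4 := mul_le_mul_of_nonneg_left h1 hlam0.le
    have h5 := hl i hi
    linarith
  obtain ⟨y, -, rfl⟩ := hpW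
  refine ⟨y, ?_, rfl⟩
  rw [Metric.mem_ball]
  have h1 := h.le_dist i y x
  have h2 : C * dist (wordMap φ i y) (wordMap φ i x) < pieceDiam φ E i * ε := by
    calc _ < C * (ε / C * pieceDiam φ E i) := mul_lt_mul_of_pos_left hp2 hC
      _ = _ := by field_simp
  exact lt_of_mul_lt_mul_left (h1.trans_lt h2) hd.le

/-- Under the open set condition, the balls required in the ball condition exist with one constant
at all points and scales. Composing with a long word `w` brings their centres as close to the
pieces as required. -/
theorem HasBoundedDistortion.exists_hasBallsAt [Nonempty ι] (h : HasBoundedDistortion φ E C b c)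
    (hsc : IsProperlySemiconformal φ E) (hO : OpenSetCondition φ) :
    ∃ δ : ℝ, 0 < δ ∧ δ < 1 ∧ ∀ (x : M) (r : ℝ), 0 < r → HasBallsAt (pieces φ E) δ x r := by
  obtain ⟨-, W, ⟨hWo, hWd, -⟩, hW, hWlam⟩ := hsc
  obtain ⟨U, hUne, hUo, hU⟩ := hO
  obtain ⟨z, hzU, hzW⟩ := hWd.inter_open_nonempty U hUo hUne
  obtain ⟨ε, hε, hεU⟩ := Metric.isOpen_iff.1 hUo z hzU
  obtain ⟨ρ, hρ, hball⟩ := h.exists_ball_subset_image hWo hW hzW (hWlam z hzW) hε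
  obtain ⟨e, he⟩ := h.invariant.1
  have hC := h.C_pos
  have hb := h.b_pos
  have hden : 0 < C ^ 2 * (dist z e + 1) := by positivity
  obtain ⟨n, hn⟩ := h.exists_length_diam_lt (one_div_pos.2 hden)
  set w : List ι := List.replicate n (Classical.arbitrary ι)
  have hw : C ^ 2 * dist z e * pieceDiam φ E w < 1 := by
    have h1 := hn w (by simp [w])
    rw [lt_div_iff₀ hden] at h1
    have h2 : 0 < C ^ 2 * pieceDiam φ E w := mul_pos (by positivity) (h.diam_pos w)
    nlinarith
  have hdw := h.diam_pos w
  refine ⟨min (1 / 2) (ρ * b * pieceDiam φ E w / C), lt_min (by norm_num) (by positivity),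
    (min_le_left _ _).trans_lt (by norm_num), fun x r hr => ?_⟩
  refine ⟨fun i => wordMap φ (i ++ w) z, ?_, ?_⟩
  · rintro i ⟨hi, -⟩
    have hmem : wordMap φ (i ++ w) e ∈ pieces φ E i :=
      h.invariant.pieces_append_subset i w ⟨e, he, rfl⟩
    refine (Metric.infDist_le_dist_of_mem hmem).trans_lt ?_
    have hdi := h.diam_pos i
    calc dist (wordMap φ (i ++ w) z) (wordMap φ (i ++ w) e)
        ≤ C * pieceDiam φ E (i ++ w) * dist z e := h.dist_le _ _ _
      _ ≤ C * (C * pieceDiam φ E i * pieceDiam φ E w) * dist z e := by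
          gcongr
          exact h.diam_append_le i w
      _ = pieceDiam φ E i * (C ^ 2 * dist z e * pieceDiam φ E w) := by ring
      _ < pieceDiam φ E i * 1 := mul_lt_mul_of_pos_left hw hdi
      _ ≤ r := by rw [mul_one]; exact hi.2.1
  · rintro i ⟨hi, -⟩ j ⟨hj, -⟩ hij
    have hsub : ∀ k ∈ stoppingWords (pieces φ E) r,
        Metric.ball (wordMap φ (k ++ w) z) (min (1 / 2) (ρ * b * pieceDiam φ E w / C) * r) ⊆
          wordMap φ (k ++ w) '' U := by
      intro k hk
      refine (Metric.ball_subset_ball ?_).trans ((hball (k ++ w) (by simp [hk.1])).trans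
        (image_mono hεU))
      have h1 := h.le_diam_append k w
      have h2 := h.le_diam_of_mem_stoppingWords hk
      calc _ ≤ ρ * b * pieceDiam φ E w / C * r :=
            mul_le_mul_of_nonneg_right (min_le_right _ _) hr.le
        _ = ρ / C * ((b * r) * pieceDiam φ E w) := by ring
        _ ≤ ρ / C * (pieceDiam φ E k * pieceDiam φ E w) := by gcongr
        _ ≤ ρ / C * (C * pieceDiam φ E (k ++ w)) := by gcongr
        _ = _ := by field_simp
    exact (hU (i ++ w) (j ++ w) ((h.incomparable_of_mem_stoppingWords hi hj hij).mono
      (List.prefix_append _ _) (List.prefix_append _ _))).mono (hsub i hi) (hsub j hj)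

/-! ### Positivity of the Hausdorff measure -/

variable [Fintype ι]

theorem sum_wordsOfLength_prefix {R : Type*} [AddCommMonoid R] [DecidableEq ι] {v : List ι} {n : ℕ}
    (hv : v.length ≤ n) (f : List ι → R) :
    ∑ w ∈ wordsOfLength ι n with v <+: w, f w =
      ∑ w ∈ wordsOfLength ι (n - v.length), f (v ++ w) := by
  symm
  refine Finset.sum_nbij (v ++ ·) ?_ ?_ ?_ (fun _ _ => rfl)
  · intro w hw
    simp only [mem_wordsOfLength, Finset.mem_filter, List.length_append] at hw ⊢
    exact ⟨by omega, List.prefix_append v w⟩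
  · exact (List.append_right_injective v).injOn
  · rintro _ hw
    simp only [Finset.coe_filter, mem_wordsOfLength, Set.mem_ofPred_eq] at hw
    obtain ⟨hn, w, rfl⟩ := hw
    refine ⟨w, ?_, rfl⟩
    simp only [Finset.mem_coe, mem_wordsOfLength]
    rw [List.length_append] at hn
    omega

variable [Nonempty ι]

/-- The mass distribution principle: if a finite family of words contains a prefix of every
sufficiently long word, then the sum of `diam (E_v) ^ t` over the family is bounded below. -/
theorem HasBoundedDistortion.diam_rpow_le_sum_of_prefix (h : HasBoundedDistortion φ E C b c) {t : ℝ}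
    (ht : 0 ≤ t) (hp : HasPressure (pieces φ E) t 0) {κ : Type*} (S : Finset κ)
    (V : κ → Finset (List ι)) (L : ℕ)
    (hV : ∀ w : List ι, L ≤ w.length → ∃ n ∈ S, ∃ v ∈ V n, v <+: w) :
    pieceDiam φ E [] ^ t ≤ (C ^ t) ^ 4 * ∑ n ∈ S, ∑ v ∈ V n, pieceDiam φ E v ^ t := by
  classical
  have hd : ∀ w, 0 < pieceDiam φ E w ^ t := fun w => Real.rpow_pos_of_pos (h.diam_pos w) t
  obtain ⟨m, hm⟩ : ∃ m, ∀ n ∈ S, ∀ v ∈ V n, v.length ≤ m := by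
    refine ⟨S.sup fun n => (V n).sup List.length, fun n hn v hv => ?_⟩
    exact (Finset.le_sup (f := List.length) hv).trans
      (Finset.le_sup (f := fun n => (V n).sup List.length) hn)
  have key : levelSum φ E t (max L m) [] ≤
      ∑ n ∈ S, ∑ v ∈ V n, (C ^ t) ^ 2 * pieceDiam φ E v ^ t := by
    calc levelSum φ E t (max L m) []
        = ∑ w ∈ wordsOfLength ι (max L m), pieceDiam φ E w ^ t := by simp [levelSum]
      _ ≤ ∑ w ∈ wordsOfLength ι (max L m), ∑ n ∈ S, ∑ v ∈ V n,
            if v <+: w then pieceDiam φ E w ^ t else 0 := by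
          refine Finset.sum_le_sum fun w hw => ?_
          rw [mem_wordsOfLength] at hw
          obtain ⟨n, hn, v, hv, hvw⟩ := hV w (by omega)
          have hnn : ∀ v, (0 : ℝ) ≤ if v <+: w then pieceDiam φ E w ^ t else 0 := by
            intro v
            split_ifs
            exacts [(hd w).le, le_rfl]
          refine le_trans ?_ (Finset.single_le_sum (f := fun n => ∑ v ∈ V n,
            if v <+: w then pieceDiam φ E w ^ t else 0)
            (fun n _ => Finset.sum_nonneg fun v _ => hnn v) hn)
          refine le_trans ?_ (Finset.single_le_sum (fun v _ => hnn v) hv)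
          rw [if_pos hvw]
      _ = ∑ n ∈ S, ∑ v ∈ V n, ∑ w ∈ wordsOfLength ι (max L m),
            if v <+: w then pieceDiam φ E w ^ t else 0 := by
          rw [Finset.sum_comm]
          refine Finset.sum_congr rfl fun n _ => Finset.sum_comm
      _ ≤ ∑ n ∈ S, ∑ v ∈ V n, (C ^ t) ^ 2 * pieceDiam φ E v ^ t := by
          refine Finset.sum_le_sum fun n hn => Finset.sum_le_sum fun v hv => ?_
          have hvL : v.length ≤ max L m := (hm n hn v hv).trans (le_max_right _ _)
          rw [← Finset.sum_filter, sum_wordsOfLength_prefix hvL]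
          exact (h.levelSum_bounds ht hp _ v).2
  have h1 := (h.levelSum_bounds ht hp (max L m) []).1
  have h2 : 0 < C ^ t := Real.rpow_pos_of_pos h.C_pos t
  simp only [← Finset.mul_sum] at key
  calc _ ≤ (C ^ t) ^ 2 * levelSum φ E t (max L m) [] := h1
    _ ≤ (C ^ t) ^ 2 * ((C ^ t) ^ 2 * ∑ n ∈ S, ∑ v ∈ V n, pieceDiam φ E v ^ t) := by gcongr
    _ = _ := by ring

/-- A bounded number of stopping words at each point and scale forces the Hausdorff measure of the
invariant set to be positive: in a cover of `E`, each set may be replaced by a ball and then by the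
boundedly many stopping words of that ball. -/
theorem HasBoundedDistortion.hausdorffMeasure_pos [MeasurableSpace M] [BorelSpace M]
    (h : HasBoundedDistortion φ E C b c) {t : ℝ}
    (ht : 0 < t) (hp : HasPressure (pieces φ E) t 0)
    (hN : ∃ N : ℕ, ∀ (x : M) (r : ℝ), 0 < r → ∀ T : Finset (List ι),
      (T : Set (List ι)) ⊆ stoppingWordsAt (pieces φ E) x r → T.card ≤ N) :
    0 < Measure.hausdorffMeasure t E := by
  classical
  obtain ⟨N, hN⟩ := hN
  set Δ := pieceDiam φ E [] with hΔ
  have hΔ0 : 0 < Δ := h.diam_pos []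
  have hK : 0 < C ^ t := Real.rpow_pos_of_pos h.C_pos t
  have hΔt : 0 < Δ ^ t := Real.rpow_pos_of_pos hΔ0 t
  obtain ⟨e, he⟩ := h.invariant.1
  obtain ⟨ε, hε, hεlt⟩ : ∃ ε : ℝ, 0 < ε ∧ (C ^ t) ^ 4 * (N * (2 * ε)) < Δ ^ t := by
    refine ⟨Δ ^ t / (2 * ((C ^ t) ^ 4 * (N * 2 + 1))), by positivity, ?_⟩
    have hN0 : (0 : ℝ) ≤ N := Nat.cast_nonneg N
    have hk4 : 0 < (C ^ t) ^ 4 := by positivity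
    have heq : (C ^ t) ^ 4 * (N * (2 * (Δ ^ t / (2 * ((C ^ t) ^ 4 * (N * 2 + 1)))))) =
        Δ ^ t * (N / (N * 2 + 1)) := by
      field_simp
    rw [heq]
    have : (N : ℝ) / (N * 2 + 1) < 1 := by
      rw [div_lt_one (by positivity)]
      linarith
    nlinarith
  rw [pos_iff_ne_zero]
  intro hzero
  -- a cover of `E` by sets of diameter at most `Δ / 2` with small sum
  obtain ⟨A, hEA, hAd, hAs⟩ : ∃ A : ℕ → Set M, E ⊆ ⋃ n, A n ∧
      (∀ n, Metric.ediam (A n) ≤ ENNReal.ofReal (Δ / 2)) ∧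
      ∑' n, (⨆ _ : (A n).Nonempty, Metric.ediam (A n) ^ t) < ENNReal.ofReal ε := by
    rw [Measure.hausdorffMeasure_apply] at hzero
    have h1 := (le_iSup₂ (f := fun (r : ENNReal) (_ : 0 < r) =>
      ⨅ (A : ℕ → Set M) (_ : E ⊆ ⋃ n, A n) (_ : ∀ n, Metric.ediam (A n) ≤ r),
        ∑' n, ⨆ _ : (A n).Nonempty, Metric.ediam (A n) ^ t)
      (ENNReal.ofReal (Δ / 2)) (ENNReal.ofReal_pos.2 (by positivity))).trans_eq hzero
    have h2 := h1.trans_lt (ENNReal.ofReal_pos.2 hε)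
    simp only [iInf_lt_iff] at h2
    obtain ⟨A, hA1, hA2, hA3⟩ := h2
    exact ⟨A, hA1, hA2, hA3⟩
  obtain ⟨ε', hε'0, hε's⟩ := ENNReal.exists_pos_sum_of_countable (ENNReal.ofReal_pos.2 hε).ne' ℕ
  have hballs : ∀ n, ∃ (x : M) (r : ℝ), 0 < r ∧ r < Δ ∧ A n ∩ E ⊆ Metric.ball x r ∧
      ENNReal.ofReal (r ^ t) ≤ (⨆ _ : (A n).Nonempty, Metric.ediam (A n) ^ t) + ε' n := by
    intro n
    have hfin : Metric.ediam (A n) ≠ ⊤ := ne_top_of_le_ne_top ENNReal.ofReal_ne_top (hAd n)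
    set D := (Metric.ediam (A n)).toReal with hD
    have hD0 : 0 ≤ D := ENNReal.toReal_nonneg
    have hDΔ : D < Δ := by
      have := ENNReal.toReal_le_of_le_ofReal (by positivity) (hAd n)
      linarith
    have hcont : Tendsto (fun r : ℝ => r ^ t) (𝓝[>] D) (𝓝 (D ^ t)) :=
      ((Real.continuous_rpow_const ht.le).tendsto D).mono_left nhdsWithin_le_nhds
    have hlt : D ^ t < D ^ t + ε' n := by
      have : (0 : ℝ) < ε' n := hε'0 n
      linarith
    obtain ⟨r, hr1, hr2, hr3⟩ := ((hcont.eventually (gt_mem_nhds hlt)).and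
      (Ioo_mem_nhdsGT hDΔ)).exists
    have hDt : ENNReal.ofReal (D ^ t) = Metric.ediam (A n) ^ t := by
      rw [← ENNReal.ofReal_rpow_of_nonneg hD0 ht.le, hD, ENNReal.ofReal_toReal hfin]
    have hle : ENNReal.ofReal (r ^ t) ≤ Metric.ediam (A n) ^ t + ε' n := by
      rw [← hDt, ← ENNReal.ofReal_coe_nnreal (p := ε' n),
        ← ENNReal.ofReal_add (by positivity) (by positivity)]
      exact ENNReal.ofReal_le_ofReal hr1.le
    have hsup : (⨆ _ : (A n).Nonempty, Metric.ediam (A n) ^ t) = Metric.ediam (A n) ^ t := by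
      by_cases hAn : (A n).Nonempty
      · simp [hAn]
      · rw [not_nonempty_iff_eq_empty.1 hAn]
        simp [ENNReal.zero_rpow_of_pos ht]
    rw [hsup]
    by_cases hAE : (A n ∩ E).Nonempty
    · obtain ⟨x, hx, -⟩ := hAE
      refine ⟨x, r, by linarith, hr3, fun y hy => ?_, hle⟩
      rw [Metric.mem_ball]
      exact (Metric.dist_le_diam_of_mem' hfin hy.1 hx).trans_lt hr2
    · rw [not_nonempty_iff_eq_empty.1 hAE]
      exact ⟨e, r, by linarith, hr3, empty_subset _, hle⟩
  choose x r hr0 hrΔ hxr hrε using hballs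
  obtain ⟨S, hS⟩ := h.invariant.2.1.elim_finite_subcover (fun n => Metric.ball (x n) (r n))
    (fun n => Metric.isOpen_ball) (fun y hy => by
      obtain ⟨n, hn⟩ := mem_iUnion.1 (hEA hy)
      exact mem_iUnion.2 ⟨n, hxr n ⟨hn, hy⟩⟩)
  have hZfin : ∀ n, (stoppingWordsAt (pieces φ E) (x n) (r n)).Finite := by
    intro n
    by_contra hinf
    obtain ⟨T, hT, hTc⟩ := Set.Infinite.exists_subset_card_eq hinf (N + 1)
    have := hN (x n) (r n) (hr0 n) T hT
    omega
  obtain ⟨L, hL⟩ : ∃ L : ℕ, ∀ n ∈ S, ∀ w : List ι, L ≤ w.length → pieceDiam φ E w < r n := by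
    choose L hL using fun n => h.exists_length_diam_lt (hr0 n)
    exact ⟨S.sup L, fun n hn w hw => hL n w ((Finset.le_sup hn).trans hw)⟩
  have hmain := h.diam_rpow_le_sum_of_prefix ht.le hp S (fun n => (hZfin n).toFinset) L (by
    intro w hw
    obtain ⟨y, hy⟩ := h.nonempty w
    obtain ⟨n, hn, hyn⟩ := mem_iUnion₂.1 (hS (h.invariant.pieces_subset w hy))
    obtain ⟨v, hvw, hv⟩ := exists_stoppingWord_prefix (hL n hn w hw).le (hrΔ n)
    refine ⟨n, hn, v, ?_, hvw⟩
    rw [Set.Finite.mem_toFinset]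
    exact ⟨hv, y, h.invariant.pieces_subset_of_prefix hvw hy, hyn⟩)
  have hsum1 : ∑ n ∈ S, ∑ v ∈ (hZfin n).toFinset, pieceDiam φ E v ^ t ≤
      N * ∑ n ∈ S, r n ^ t := by
    rw [Finset.mul_sum]
    refine Finset.sum_le_sum fun n _ => ?_
    calc _ ≤ ∑ v ∈ (hZfin n).toFinset, r n ^ t := by
          refine Finset.sum_le_sum fun v hv => Real.rpow_le_rpow (h.diam_pos v).le ?_ ht.le
          rw [Set.Finite.mem_toFinset] at hv
          exact hv.1.2.1
      _ = (hZfin n).toFinset.card * r n ^ t := by rw [Finset.sum_const, nsmul_eq_mul]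
      _ ≤ N * r n ^ t := by
          refine mul_le_mul_of_nonneg_right ?_ (Real.rpow_nonneg (hr0 n).le t)
          exact_mod_cast hN (x n) (r n) (hr0 n) _ (by simp)
  have hsum2 : ∑ n ∈ S, r n ^ t ≤ 2 * ε := by
    rw [← ENNReal.ofReal_le_ofReal_iff (by positivity),
      ENNReal.ofReal_sum_of_nonneg fun n _ => Real.rpow_nonneg (hr0 n).le t]
    calc _ ≤ ∑ n ∈ S, ((⨆ _ : (A n).Nonempty, Metric.ediam (A n) ^ t) + ε' n) :=
          Finset.sum_le_sum fun n _ => hrε n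
      _ ≤ ∑' n, ((⨆ _ : (A n).Nonempty, Metric.ediam (A n) ^ t) + ε' n) :=
          ENNReal.sum_le_tsum S
      _ = ∑' n, (⨆ _ : (A n).Nonempty, Metric.ediam (A n) ^ t) + ∑' n, (ε' n : ENNReal) :=
          ENNReal.tsum_add
      _ ≤ ENNReal.ofReal ε + ENNReal.ofReal ε := add_le_add hAs.le hε's.le
      _ = ENNReal.ofReal (2 * ε) := by
          rw [← ENNReal.ofReal_add hε.le hε.le, two_mul]
  have : Δ ^ t ≤ (C ^ t) ^ 4 * (N * (2 * ε)) := by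
    refine hmain.trans (mul_le_mul_of_nonneg_left (hsum1.trans ?_) (by positivity))
    exact mul_le_mul_of_nonneg_left hsum2 (Nat.cast_nonneg N)
  linarith

end MoranIFS

namespace MoranIFS

variable {ι M : Type*} [MetricSpace M] {φ : ι → M → M} {E : Set M} {C b c : ℝ}

/-! ### Positive Hausdorff measure bounds the clusters -/

theorem HasBoundedDistortion.ediam_pieces (h : HasBoundedDistortion φ E C b c) (w : List ι) :
    Metric.ediam (pieces φ E w) = ENNReal.ofReal (pieceDiam φ E w) :=
  (ENNReal.ofReal_toReal (h.isCompact w).isBounded.ediam_ne_top).symm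

variable [Fintype ι] [Nonempty ι]

/-- The step of the exhaustion. Let `F` be a family of incomparable words whose pieces have diameter
at least `b * ρ` and lie together in a set of diameter `5 * ρ`, and let `G` consist of the words of
some length `L` that extend a member of `F`. In the piece of `u`, the sum over `G` is a fixed
proportion of the whole, while the image of the union of the pieces of `F` can be covered by one
set at a cost smaller by a factor of the order of `1 / card F`. -/
theorem HasBoundedDistortion.exists_extensions (h : HasBoundedDistortion φ E C b c) {t : ℝ}
    (ht : 0 ≤ t) (hp : HasPressure (pieces φ E) t 0) {F : Finset (List ι)} (hF0 : F.Nonempty)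
    (hF : ∀ v ∈ F, ∀ w ∈ F, v ≠ w → Incomparable v w) {ρ : ℝ} (hρ : 0 < ρ)
    (hFρ : ∀ v ∈ F, b * ρ ≤ pieceDiam φ E v) :
    ∃ (L : ℕ) (G : Finset (List ι)) (θ : ℝ), G ⊆ wordsOfLength ι L ∧
      (∀ w ∈ G, ∃ v ∈ F, v <+: w) ∧ 0 < θ ∧ θ ≤ 1 ∧ ∀ n u,
        θ * levelSum φ E t (L + n) u ≤ ∑ w ∈ G, levelSum φ E t n (u ++ w) ∧
        (5 * C * ρ * pieceDiam φ E u) ^ t ≤ (C ^ t) ^ 2 * (5 * C ^ 2 / b) ^ t / F.card *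
          ∑ w ∈ G, levelSum φ E t n (u ++ w) := by
  classical
  have hC := h.C_pos
  have hb := h.b_pos
  set K := (C ^ t) ^ 2 with hK
  have hK0 : 0 < K := by positivity
  have hcard : (0 : ℝ) < F.card := by exact_mod_cast hF0.card_pos
  have hcard1 : (1 : ℝ) ≤ F.card := by exact_mod_cast hF0.card_pos
  set L := F.sup List.length with hL
  set G := F.biUnion fun v => (wordsOfLength ι L).filter (v <+: ·) with hG
  have hGL : G ⊆ wordsOfLength ι L := by
    rw [hG, Finset.biUnion_subset]
    exact fun v _ => Finset.filter_subset _ _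
  have hsum : ∀ n u, ∑ w ∈ G, levelSum φ E t n (u ++ w) =
      ∑ v ∈ F, levelSum φ E t (L - v.length + n) (u ++ v) := by
    intro n u
    rw [hG, Finset.sum_biUnion]
    · refine Finset.sum_congr rfl fun v hv => ?_
      have hvL : v.length ≤ L := Finset.le_sup (f := List.length) hv
      rw [sum_wordsOfLength_prefix hvL, levelSum_add]
      simp only [List.append_assoc]
    · intro v hv w hw hvw
      rw [Function.onFun, Finset.disjoint_left]
      intro z hz hz'
      rw [Finset.mem_filter] at hz hz'
      exact ((hF v hv w hw hvw).mono hz.2 hz'.2).ne rfl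
  set τ := (b * ρ / C) ^ t with hτ
  have hτ0 : 0 < τ := Real.rpow_pos_of_pos (by positivity) t
  -- every member of `F` contributes at least `τ / K` times the term of `u`
  have hlow : ∀ n u, F.card * (pieceDiam φ E u ^ t * τ) ≤
      K * ∑ w ∈ G, levelSum φ E t n (u ++ w) := by
    intro n u
    rw [hsum, Finset.mul_sum, ← nsmul_eq_mul]
    refine Finset.card_nsmul_le_sum _ _ _ fun v hv => ?_
    refine le_trans ?_ (h.levelSum_bounds ht hp _ _).1
    have hu := h.diam_pos u
    rw [hτ, ← Real.mul_rpow hu.le (by positivity)]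
    refine Real.rpow_le_rpow (by positivity) ?_ ht
    refine le_of_mul_le_mul_left ?_ hC
    calc C * (pieceDiam φ E u * (b * ρ / C)) = pieceDiam φ E u * (b * ρ) := by field_simp
      _ ≤ pieceDiam φ E u * pieceDiam φ E v := mul_le_mul_of_nonneg_left (hFρ v hv) hu.le
      _ ≤ _ := h.le_diam_append u v
  have hθ : ∀ n u, τ / K ^ 2 * levelSum φ E t (L + n) u ≤
      ∑ w ∈ G, levelSum φ E t n (u ++ w) := by
    intro n u
    have h1 := (h.levelSum_bounds ht hp (L + n) u).2
    have h2 := hlow n u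
    have hu := Real.rpow_pos_of_pos (h.diam_pos u) t
    refine le_of_mul_le_mul_left ?_ hK0
    calc K * (τ / K ^ 2 * levelSum φ E t (L + n) u)
        ≤ K * (τ / K ^ 2 * (K * pieceDiam φ E u ^ t)) := by gcongr
      _ = 1 * (pieceDiam φ E u ^ t * τ) := by field_simp
      _ ≤ F.card * (pieceDiam φ E u ^ t * τ) := by gcongr
      _ ≤ _ := h2
  refine ⟨L, G, τ / K ^ 2, hGL, ?_, by positivity, ?_, fun n u => ⟨hθ n u, ?_⟩⟩
  · intro w hw
    obtain ⟨v, hv, hw⟩ := Finset.mem_biUnion.1 hw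
    exact ⟨v, hv, (Finset.mem_filter.1 hw).2⟩
  · have h1 := hθ 0 []
    have h2 : ∑ w ∈ G, levelSum φ E t 0 ([] ++ w) ≤ levelSum φ E t (L + 0) [] := by
      rw [levelSum_add]
      exact Finset.sum_le_sum_of_subset_of_nonneg hGL fun w _ _ => (h.levelSum_pos t 0 _).le
    have h3 := h.levelSum_pos t (L + 0) []
    nlinarith
  · have hu := h.diam_pos u
    have heq : (5 * C * ρ * pieceDiam φ E u) ^ t =
        (5 * C ^ 2 / b) ^ t * (pieceDiam φ E u ^ t * τ) := by
      rw [hτ, ← Real.mul_rpow hu.le (by positivity),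
        ← Real.mul_rpow (by positivity) (by positivity)]
      congr 1
      field_simp
    have h5 : 0 < (5 * C ^ 2 / b) ^ t := Real.rpow_pos_of_pos (by positivity) t
    calc _ = (5 * C ^ 2 / b) ^ t / F.card * (F.card * (pieceDiam φ E u ^ t * τ)) := by
          rw [heq]
          field_simp
      _ ≤ (5 * C ^ 2 / b) ^ t / F.card * (K * ∑ w ∈ G, levelSum φ E t n (u ++ w)) := by
          exact mul_le_mul_of_nonneg_left (hlow n u) (by positivity)
      _ = _ := by ring

/-- The exhaustion, for an outer measure `H` bounded by `diam ^ t` on small sets. In each round the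
pieces of the words in `G` are covered by one image of `A`, at cost at most `γ` times their share
of the sum, and the share of what is left decreases by the factor `1 - θ`. -/
theorem HasBoundedDistortion.outerMeasure_pieces_le (h : HasBoundedDistortion φ E C b c) {t : ℝ}
    (ht : 0 < t) {H : OuterMeasure M} {δ : ENNReal}
    (hH : ∀ s : Set M, Metric.ediam s ≤ δ → H s ≤ Metric.ediam s ^ t)
    {A : Set M} (hAE : A ⊆ E) {σ : ℝ} (hσ : 0 < σ) (hAσ : ∀ x ∈ A, ∀ y ∈ A, dist x y ≤ σ)
    {L : ℕ} {G : Finset (List ι)} (hGL : G ⊆ wordsOfLength ι L)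
    (hGA : ∀ w ∈ G, pieces φ E w ⊆ A) {θ γ : ℝ} (hθ : θ ≤ 1) (hγ : 0 ≤ γ)
    (hG : ∀ n u, θ * levelSum φ E t (L + n) u ≤ ∑ w ∈ G, levelSum φ E t n (u ++ w) ∧
      (C * σ * pieceDiam φ E u) ^ t ≤ γ * ∑ w ∈ G, levelSum φ E t n (u ++ w))
    (n : ℕ) (u : List ι) (hu : Metric.ediam (pieces φ E u) ≤ δ) :
    H (pieces φ E u) ≤ ENNReal.ofReal ((γ + (1 - θ) ^ n) * levelSum φ E t (n * L) u) := by
  classical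
  have hC := h.C_pos
  have hlev : ∀ n u, 0 ≤ levelSum φ E t n u := fun n u => (h.levelSum_pos t n u).le
  have hq : 0 ≤ 1 - θ := by linarith
  induction n generalizing u with
  | zero =>
    refine (hH _ hu).trans ?_
    have hd := h.diam_pos u
    rw [h.ediam_pieces, ENNReal.ofReal_rpow_of_pos hd, zero_mul, levelSum_zero]
    refine ENNReal.ofReal_le_ofReal (le_mul_of_one_le_left (by positivity) ?_)
    simpa using hγ
  | succ n ih =>
    obtain ⟨h1, h2⟩ := hG (n * L) u
    have hqn : 0 ≤ (1 - θ) ^ n := pow_nonneg hq n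
    have hβ : 0 ≤ γ + (1 - θ) ^ n := add_nonneg hγ hqn
    have hrest : ∑ w ∈ wordsOfLength ι L \ G, levelSum φ E t (n * L) (u ++ w) =
        levelSum φ E t (L + n * L) u - ∑ w ∈ G, levelSum φ E t (n * L) (u ++ w) := by
      rw [levelSum_add, ← Finset.sum_sdiff hGL, add_sub_cancel_right]
    have hrest0 : 0 ≤ ∑ w ∈ wordsOfLength ι L \ G, levelSum φ E t (n * L) (u ++ w) :=
      Finset.sum_nonneg fun w _ => hlev _ _
    have hs0 : 0 ≤ ∑ w ∈ G, levelSum φ E t (n * L) (u ++ w) :=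
      Finset.sum_nonneg fun w _ => hlev _ _
    have hcov : pieces φ E u ⊆ wordMap φ u '' A ∪
        ⋃ w ∈ wordsOfLength ι L \ G, pieces φ E (u ++ w) := by
      intro x hx
      obtain ⟨w, hw, hxw⟩ := h.invariant.exists_mem_pieces_append hx L
      by_cases hwG : w ∈ G
      · left
        rw [pieces_append] at hxw
        exact image_mono (hGA w hwG) hxw
      · right
        exact mem_iUnion₂.2 ⟨w, by simp [hw, hwG], hxw⟩
    have hHA : H (wordMap φ u '' A) ≤
        ENNReal.ofReal (γ * ∑ w ∈ G, levelSum φ E t (n * L) (u ++ w)) := by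
      have hsub : wordMap φ u '' A ⊆ pieces φ E u := image_mono hAE
      have hd0 := h.diam_pos u
      refine (hH _ ((Metric.ediam_mono hsub).trans hu)).trans ?_
      have hd : Metric.ediam (wordMap φ u '' A) ≤ ENNReal.ofReal (C * σ * pieceDiam φ E u) := by
        refine Metric.ediam_le ?_
        rintro _ ⟨x, hx, rfl⟩ _ ⟨y, hy, rfl⟩
        rw [edist_dist]
        refine ENNReal.ofReal_le_ofReal ((h.dist_le u x y).trans ?_)
        calc _ ≤ C * pieceDiam φ E u * σ :=
              mul_le_mul_of_nonneg_left (hAσ x hx y hy) (by positivity)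
          _ = _ := by ring
      refine (ENNReal.rpow_le_rpow hd ht.le).trans ?_
      rw [ENNReal.ofReal_rpow_of_pos (by positivity)]
      exact ENNReal.ofReal_le_ofReal h2
    have hHrest : H (⋃ w ∈ wordsOfLength ι L \ G, pieces φ E (u ++ w)) ≤
        ENNReal.ofReal ((γ + (1 - θ) ^ n) *
          ∑ w ∈ wordsOfLength ι L \ G, levelSum φ E t (n * L) (u ++ w)) := by
      refine (measure_biUnion_finset_le _ _).trans ?_
      rw [Finset.mul_sum, ENNReal.ofReal_sum_of_nonneg]
      · refine Finset.sum_le_sum fun w _ => ih _ ((Metric.ediam_mono ?_).trans hu)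
        exact h.invariant.pieces_append_subset u w
      · exact fun w _ => mul_nonneg hβ (hlev _ _)
    refine (measure_mono hcov).trans ((measure_union_le _ _).trans
      ((add_le_add hHA hHrest).trans ?_))
    rw [← ENNReal.ofReal_add (mul_nonneg hγ hs0) (mul_nonneg hβ hrest0)]
    refine ENNReal.ofReal_le_ofReal ?_
    rw [hrest, show (n + 1) * L = L + n * L by ring, pow_succ]
    have := mul_le_mul_of_nonneg_left h1 hqn
    linarith

/-- Exhausting `E` by images of a bounded set that contains all pieces of a family `F` of
incomparable words shows that the Hausdorff measure of `E` is at most of the order of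
`1 / card F`. -/
theorem HasBoundedDistortion.hausdorffMeasure_le [MeasurableSpace M] [BorelSpace M]
    (h : HasBoundedDistortion φ E C b c) {t : ℝ}
    (ht : 0 < t) (hp : HasPressure (pieces φ E) t 0) {F : Finset (List ι)} (hF0 : F.Nonempty)
    (hF : ∀ v ∈ F, ∀ w ∈ F, v ≠ w → Incomparable v w) {ρ : ℝ} (hρ : 0 < ρ)
    (hFρ : ∀ v ∈ F, b * ρ ≤ pieceDiam φ E v)
    (hF5 : ∀ x ∈ ⋃ v ∈ F, pieces φ E v, ∀ y ∈ ⋃ v ∈ F, pieces φ E v, dist x y ≤ 5 * ρ) :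
    Measure.hausdorffMeasure t E ≤ ENNReal.ofReal ((C ^ t) ^ 2 * (5 * C ^ 2 / b) ^ t / F.card *
      ((C ^ t) ^ 2 * pieceDiam φ E [] ^ t)) := by
  have hC := h.C_pos
  have hb := h.b_pos
  obtain ⟨L, G, θ, hGL, hGF, hθ0, hθ1, hG⟩ := h.exists_extensions ht.le hp hF0 hF hρ hFρ
  set γ := (C ^ t) ^ 2 * (5 * C ^ 2 / b) ^ t / F.card with hγ
  have hγ0 : 0 ≤ γ := by positivity
  have hlev : ∀ n u, 0 ≤ levelSum φ E t n u := fun n u => (h.levelSum_pos t n u).le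
  have hq : 0 ≤ 1 - θ := by linarith
  rw [Measure.hausdorffMeasure, ← Measure.coe_toOuterMeasure, Measure.mkMetric_toOuterMeasure,
    OuterMeasure.mkMetric, OuterMeasure.mkMetric']
  simp only [OuterMeasure.iSup_apply]
  refine iSup₂_le fun δ hδ => ?_
  set H := OuterMeasure.mkMetric'.pre (fun s : Set M => Metric.ediam s ^ t) δ with hH
  have hround := h.outerMeasure_pieces_le ht (H := H) (δ := δ)
    (fun s hs => OuterMeasure.mkMetric'.pre_le hs)
    (iUnion₂_subset fun v _ => h.invariant.pieces_subset v) (by positivity) hF5 hGL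
    (fun w hw => by
      obtain ⟨v, hv, hvw⟩ := hGF w hw
      exact (h.invariant.pieces_subset_of_prefix hvw).trans
        (subset_biUnion_of_mem (u := fun v => pieces φ E v) hv)) hθ1 hγ0
    (fun n u => by
      rw [show C * (5 * ρ) * pieceDiam φ E u = 5 * C * ρ * pieceDiam φ E u by ring]
      exact hG n u)
  obtain ⟨m, hm⟩ : ∃ m : ℕ, ∀ w ∈ wordsOfLength ι m, Metric.ediam (pieces φ E w) ≤ δ := by
    rcases eq_or_ne δ ⊤ with rfl | hδt
    · exact ⟨0, fun w _ => le_top⟩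
    · obtain ⟨m, hm⟩ := h.exists_length_diam_lt (ENNReal.toReal_pos hδ.ne' hδt)
      refine ⟨m, fun w hw => ?_⟩
      rw [h.ediam_pieces, ENNReal.ofReal_le_iff_le_toReal hδt]
      rw [mem_wordsOfLength] at hw
      exact (hm w hw.ge).le
  have hbound : ∀ n : ℕ, H E ≤ ENNReal.ofReal
      ((γ + (1 - θ) ^ n) * ((C ^ t) ^ 2 * pieceDiam φ E [] ^ t)) := by
    intro n
    have hβ : 0 ≤ γ + (1 - θ) ^ n := add_nonneg hγ0 (pow_nonneg hq n)
    have hcov : E ⊆ ⋃ w ∈ wordsOfLength ι m, pieces φ E w := by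
      intro x hx
      obtain ⟨w, hw, hxw⟩ := h.invariant.exists_mem_pieces hx m
      exact mem_iUnion₂.2 ⟨w, by simpa using hw, hxw⟩
    have hsum : ENNReal.ofReal ((γ + (1 - θ) ^ n) * levelSum φ E t (m + n * L) []) =
        ∑ w ∈ wordsOfLength ι m,
          ENNReal.ofReal ((γ + (1 - θ) ^ n) * levelSum φ E t (n * L) w) := by
      rw [levelSum_add, Finset.mul_sum, ENNReal.ofReal_sum_of_nonneg]
      · simp only [List.nil_append]
      · exact fun w _ => mul_nonneg hβ (hlev _ _)
    calc H E ≤ ∑ w ∈ wordsOfLength ι m, H (pieces φ E w) :=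
          (measure_mono hcov).trans (measure_biUnion_finset_le _ _)
      _ ≤ ∑ w ∈ wordsOfLength ι m,
            ENNReal.ofReal ((γ + (1 - θ) ^ n) * levelSum φ E t (n * L) w) :=
          Finset.sum_le_sum fun w hw => hround n w (hm w hw)
      _ = ENNReal.ofReal ((γ + (1 - θ) ^ n) * levelSum φ E t (m + n * L) []) := hsum.symm
      _ ≤ _ := ENNReal.ofReal_le_ofReal
          (mul_le_mul_of_nonneg_left (h.levelSum_bounds ht.le hp _ _).2 hβ)
  have hlim : Tendsto (fun n : ℕ => ENNReal.ofReal
      ((γ + (1 - θ) ^ n) * ((C ^ t) ^ 2 * pieceDiam φ E [] ^ t))) atTop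
      (𝓝 (ENNReal.ofReal (γ * ((C ^ t) ^ 2 * pieceDiam φ E [] ^ t)))) := by
    refine ENNReal.tendsto_ofReal (Tendsto.mul_const _ ?_)
    have := (tendsto_pow_atTop_nhds_zero_of_lt_one hq (by linarith)).const_add γ
    rwa [add_zero] at this
  exact ge_of_tendsto' hlim hbound

/-- If the Hausdorff measure of the invariant set is positive, then clusters are bounded in size. -/
theorem HasBoundedDistortion.isCluster_card_le_of_hausdorffMeasure_pos [MeasurableSpace M]
    [BorelSpace M] (h : HasBoundedDistortion φ E C b c) {t : ℝ} (ht : 0 < t)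
    (hp : HasPressure (pieces φ E) t 0) (hpos : 0 < Measure.hausdorffMeasure t E) :
    ∃ N : ℕ, ∀ k F, IsCluster φ E k F → F.card ≤ N := by
  classical
  have hbound : ∀ k F, IsCluster φ E k F → F.Nonempty → Measure.hausdorffMeasure t E ≤
      ENNReal.ofReal ((C ^ t) ^ 2 * (5 * C ^ 2 / b) ^ t / F.card *
        ((C ^ t) ^ 2 * pieceDiam φ E [] ^ t)) := by
    intro k F hF hF0
    set ρ := pieceDiam φ E k with hρ
    have hρ0 : 0 < ρ := h.diam_pos k
    -- shrink the members of the cluster to stopping words of the same size as `k`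
    have hext : ∀ w ∈ F, ∃ v, w <+: v ∧ v ∈ stoppingWords (pieces φ E) ρ ∧
        ∃ x ∈ pieces φ E v, ∃ y ∈ pieces φ E k, dist x y ≤ ρ := by
      intro w hw
      obtain ⟨h1, x, hx, y, hy, hxy⟩ := hF.2 [] w hw
      simp only [List.nil_append] at h1 hx hy hxy
      obtain ⟨v, hv, hvr, hxv⟩ := h.exists_stoppingWord_extending hρ0 (by linarith) hx
      exact ⟨v, hv, hvr, x, hxv, y, hy, hxy⟩
    choose! v hv hvr hvx using hext
    have hinj : Set.InjOn v F := by
      intro w hw w' hw' hww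
      by_contra hne
      exact ((hF.1 w hw w' hw' hne).mono (hv w hw) (hv w' hw')).ne hww
    have hmemF : ∀ w ∈ F.image v, w ∈ stoppingWords (pieces φ E) ρ := by
      intro w hw
      obtain ⟨w', hw', rfl⟩ := Finset.mem_image.1 hw
      exact hvr w' hw'
    rw [← Finset.card_image_of_injOn hinj]
    refine h.hausdorffMeasure_le ht hp (hF0.image v)
      (fun w hw w' hw' => h.incomparable_of_mem_stoppingWords (hmemF w hw) (hmemF w' hw')) hρ0
      (fun w hw => h.le_diam_of_mem_stoppingWords (hmemF w hw)) ?_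
    have hnear : ∀ x ∈ ⋃ w ∈ F.image v, pieces φ E w, ∃ y ∈ pieces φ E k, dist x y ≤ 2 * ρ := by
      intro x hx
      obtain ⟨w, hw, hxw⟩ := mem_iUnion₂.1 hx
      obtain ⟨w', hw', rfl⟩ := Finset.mem_image.1 hw
      obtain ⟨x', hx', y, hy, hxy⟩ := hvx w' hw'
      refine ⟨y, hy, ?_⟩
      have h1 := (h.dist_le_diam hxw hx').trans (hvr w' hw').2.1
      have := dist_triangle x x' y
      linarith
    intro x hx x' hx'
    obtain ⟨y, hy, hxy⟩ := hnear x hx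
    obtain ⟨y', hy', hxy'⟩ := hnear x' hx'
    have h1 := h.dist_le_diam hy hy'
    have h2 := dist_triangle4 x y y' x'
    rw [dist_comm y' x'] at h2
    linarith
  by_contra hno
  push Not at hno
  set Q := (C ^ t) ^ 2 * (5 * C ^ 2 / b) ^ t * ((C ^ t) ^ 2 * pieceDiam φ E [] ^ t) with hQ
  have hC := h.C_pos
  have hb := h.b_pos
  have hQ0 : 0 ≤ Q := by
    have := h.diam_pos []
    positivity
  have hle : ∀ N : ℕ, Measure.hausdorffMeasure t E ≤ ENNReal.ofReal (Q / ((N : ℝ) + 1)) := by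
    intro N
    obtain ⟨k, F, hF, hN⟩ := hno N
    refine (hbound k F hF (Finset.card_pos.1 (by omega))).trans (ENNReal.ofReal_le_ofReal ?_)
    have hN' : (N : ℝ) + 1 ≤ F.card := by exact_mod_cast hN
    rw [div_mul_eq_mul_div, ← hQ]
    exact div_le_div_of_nonneg_left hQ0 (by positivity) hN'
  have hlim : Tendsto (fun N : ℕ => ENNReal.ofReal (Q / ((N : ℝ) + 1))) atTop (𝓝 0) := by
    rw [← ENNReal.ofReal_zero]
    refine ENNReal.tendsto_ofReal ?_
    have := (tendsto_const_div_atTop_nhds_zero_nat Q).comp (tendsto_add_atTop_nat 1)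
    refine this.congr fun N => ?_
    simp
  exact absurd (ge_of_tendsto' hlim hle) (not_le.2 hpos)

end MoranIFS

theorem mainTheorem1 {ι M : Type*} [Fintype ι] (hι : 2 ≤ Fintype.card ι)
    [MetricSpace M] [CompleteSpace M] [MeasurableSpace M] [BorelSpace M]
    (hM : MoranIFS.IsDoubling M)
    (φ : ι → M → M) (hφ : MoranIFS.IsIFS φ)
    (E : Set M) (hE : MoranIFS.IsInvariantSet φ E)
    (hsc : MoranIFS.IsProperlySemiconformal φ E) :
    (∃! t : ℝ, 0 ≤ t ∧ MoranIFS.HasPressure (MoranIFS.pieces φ E) t 0) ∧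
    ∀ t : ℝ, 0 ≤ t → MoranIFS.HasPressure (MoranIFS.pieces φ E) t 0 →
      List.TFAE
        [MoranIFS.BallCondition φ E,
         0 < Measure.hausdorffMeasure t E,
         MoranIFS.OpenSetCondition φ,
         MoranIFS.StrongOpenSetCondition φ E] := by
  have : Nonempty ι := Fintype.card_pos_iff.1 (by omega)
  obtain ⟨C, b, c, h⟩ := hsc.1.exists_hasBoundedDistortion hφ hE
  refine ⟨h.existsUnique_hasPressure_zero, fun t ht0 hp => ?_⟩
  have ht := MoranIFS.pos_of_hasPressure_zero hι ht0 hp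
  tfae_have 1 → 4 := fun hball => h.strongOpenSetCondition_of_isCluster_card_le
    (h.isCluster_card_le_of_moranBallCondition hM hball.2)
  tfae_have 2 → 4 := fun hpos => h.strongOpenSetCondition_of_isCluster_card_le
    (h.isCluster_card_le_of_hausdorffMeasure_pos ht hp hpos)
  tfae_have 4 → 3 := fun ⟨U, hU, _⟩ => ⟨U, hU⟩
  tfae_have 3 → 1 := by
    intro hO
    obtain ⟨δ, hδ0, hδ1, hδ⟩ := h.exists_hasBallsAt hsc hO
    exact ⟨h.isWCMC, δ, hδ0, hδ1, fun x _ => ⟨1, one_pos, fun r hr _ => hδ x r hr⟩⟩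
  tfae_have 3 → 2 := by
    intro hO
    obtain ⟨δ, hδ0, -, hδ⟩ := h.exists_hasBallsAt hsc hO
    obtain ⟨N, hN⟩ := h.exists_card_stoppingWordsAt_le hM hδ0
    exact h.hausdorffMeasure_pos ht hp ⟨N, fun x r hr => hN x r hr (hδ x r hr)⟩
  tfae_finish
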